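/- Let $K$ be a field, $n\in\mathbb N$, and $S=K[X_1,\dots,X_n]$ with the $\mathbb Z^n$-grading in which $X_l$ has degree the $l$-th standard basis vector of $\mathbb Z^n$; write $|a|=a_1+\dots+a_n$ for $a\in\mathbb Z^n$. Let $M$ be a finitely generated $\mathbb Z^n$-graded $S$-module. With $K=S/(X_1,\dots,X_n)$, put $$\beta_{i,a}(M)=\dim_K \operatorname{Tor}_i^S(M,K)_a\quad (i\in\mathbb N,\ a\in\mathbb Z^n),\qquad \beta_{i,j}(M)=\sum_{a\in\mathbb Z^n,\ |a|=j}\beta_{i,a}(M)\quad (j\in\mathbb Z).$$ Let $\operatorname{reg}(M)=\max\{j\in\mathbb Z : \beta_{i,i+j}(M)\neq 0\text{ for some } i\in\mathbb N\}$ (for $M=0$ give it any value; all Betti numbers are then zero), and for $k\in\{1,\dots,n\}$ let $$d_k(M)=\min\bigl(\{j\in\mathbb Z : \beta_{k,k+j}(M)\neq 0\}\cup\{\operatorname{reg}(M)\}\bigr),\qquad \beta_i^{k,\mathrm{lin}}(M)=\beta_{i,i+d_k(M)}(M)\quad (i\ge k).$$ Theorem. Let $k\in\{1,\dots,n\}$.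 If $\beta_p^{k,\mathrm{lin}}(M)\neq 0$ for some integer $p\geq k$, then $$\beta_i^{k,\mathrm{lin}}(M)\ \geq\ \binom{p}{i}\qquad\text{for all } i \text{ with } k\le i\le p.$$ -/

import Mathlib

open MvPolynomial

noncomputable section

namespace MultigradedBetti

universe u v

section Grading

variable (K : Type u) [Field K] (n : ℕ)

/-- The homogeneous pieces `S_a`, `a ∈ ℤ^n`, of `S = K[X_1, …, X_n]` for the grading in which
`X_i` has degree the `i`-th standard basis vector. -/
def polyPiece (a : Fin n → ℤ) : Submodule K (MvPolynomial (Fin n) K) :=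
  weightedHomogeneousSubmodule K (fun i : Fin n => (Pi.single i 1 : Fin n → ℤ)) a

variable {n}

/-- The degree `a` piece of the graded free module `⨁_{b ∈ B} S(-δ b)`, whose basis element
indexed by `b` is homogeneous of degree `δ b`. -/
def freePiece {B : Type v} (δ : B → Fin n → ℤ) (a : Fin n → ℤ) :
    Submodule K (B →₀ MvPolynomial (Fin n) K) where
  carrier := {f | ∀ b, f b ∈ polyPiece K n (a - δ b)}
  add_mem' hf hg b := Submodule.add_mem _ (hf b) (hg b)
  zero_mem' _ := Submodule.zero_mem _
  smul_mem' c _ hf b := Submodule.smul_mem _ c (hf b)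

end Grading

/-- A `ℤ^n`-graded free resolution `⋯ → F_1 → F_0 → M → 0` of the graded module `M = ⨁ ℳ a`, with
`F_i = ⨁_{b ∈ B i} S(-deg i b)` and homogeneous maps of degree `0`. -/
structure FreeResolution (K : Type u) [Field K] (n : ℕ) {M : Type v} [AddCommGroup M]
    [Module (MvPolynomial (Fin n) K) M] (ℳ : (Fin n → ℤ) → AddSubgroup M) where
  B : ℕ → Type (max u v)
  deg : ∀ i, B i → Fin n → ℤ
  aug : (B 0 →₀ MvPolynomial (Fin n) K) →ₗ[MvPolynomial (Fin n) K] M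
  d : ∀ i, (B (i + 1) →₀ MvPolynomial (Fin n) K) →ₗ[MvPolynomial (Fin n) K]
    (B i →₀ MvPolynomial (Fin n) K)
  aug_mem : ∀ a, ∀ x ∈ freePiece K (deg 0) a, aug x ∈ ℳ a
  d_mem : ∀ i a, ∀ x ∈ freePiece K (deg (i + 1)) a, d i x ∈ freePiece K (deg i) a
  aug_surjective : Function.Surjective aug
  exact_zero : Function.Exact (d 0) aug
  exact_succ : ∀ i, Function.Exact (d (i + 1)) (d i)

/-! Every graded module has such a resolution: cover `M` by the graded free module on all of its
homogeneous elements, and iterate with the kernels. -/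

section Existence

variable {K : Type u} [Field K] {n : ℕ}

local notation "S" => MvPolynomial (Fin n) K

lemma mul_mem_polyPiece {a b : Fin n → ℤ} {p q : S} (hp : p ∈ polyPiece K n a)
    (hq : q ∈ polyPiece K n b) : p * q ∈ polyPiece K n (a + b) :=
  IsWeightedHomogeneous.mul hp hq

lemma iSup_polyPiece : ⨆ a, polyPiece K n a = ⊤ := by
  let := weightedDecomposition K (fun i : Fin n => (Pi.single i 1 : Fin n → ℤ))
  have := (DirectSum.Decomposition.isInternal (weightedHomogeneousSubmodule K
    (fun i : Fin n => (Pi.single i 1 : Fin n → ℤ)))).submodule_iSup_eq_top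
  exact this

lemma iSup_freePiece {B : Type v} (δ : B → Fin n → ℤ) : ⨆ a, freePiece K δ a = ⊤ := by
  rw [eq_top_iff]
  rintro x -
  induction x using Finsupp.induction_linear with
  | zero => exact Submodule.zero_mem _
  | add f g hf hg => exact Submodule.add_mem _ hf hg
  | single b p =>
    have hp : p ∈ ⨆ a, polyPiece K n a := by rw [iSup_polyPiece]; trivial
    induction hp using Submodule.iSup_induction' with
    | mem a p hp =>
      refine Submodule.mem_iSup_of_mem (a + δ b) fun b' => ?_
      by_cases h : b = b'
      · subst h; simpa using hp
      · rw [Finsupp.single_eq_of_ne' h]; exact Submodule.zero_mem _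
    | zero => simp
    | add p q _ _ hp hq => rw [Finsupp.single_add]; exact Submodule.add_mem _ hp hq

/-- A family of homogeneous elements of pairwise distinct degrees with sum zero vanishes. -/
def SumFree {N : Type*} [AddCommGroup N] (P : (Fin n → ℤ) → Set N) : Prop :=
  ∀ (s : Finset (Fin n → ℤ)) (y : (Fin n → ℤ) → N), (∀ a ∈ s, y a ∈ P a) →
    ∑ a ∈ s, y a = 0 → ∀ a ∈ s, y a = 0

lemma sumFree_freePiece {B : Type v} (δ : B → Fin n → ℤ) :
    SumFree (fun a => (freePiece K δ a : Set (B →₀ S))) := by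
  intro s y hy h0 a ha
  ext1 b
  have h := congrArg (fun f : B →₀ S => weightedHomogeneousComponent
    (fun i : Fin n => (Pi.single i 1 : Fin n → ℤ)) (a - δ b) (f b)) h0
  simp only [Finsupp.finsetSum_apply, map_sum, Finsupp.coe_zero, Pi.zero_apply, map_zero] at h
  rw [Finset.sum_eq_single a] at h
  · rwa [IsWeightedHomogeneous.weightedHomogeneousComponent_same (hy a ha b)] at h
  · intro c hc hca
    refine IsWeightedHomogeneous.weightedHomogeneousComponent_ne _ (hy c hc b) ?_
    simpa [eq_comm] using hca
  · exact fun h => absurd ha h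

lemma sumFree_of_decomposition {M : Type v} [AddCommGroup M] (ℳ : (Fin n → ℤ) → AddSubgroup M)
    [DirectSum.Decomposition ℳ] : SumFree (fun a => (ℳ a : Set M)) := by
  intro s y hy h0 a ha
  have h := congrArg (fun m => ((DirectSum.decompose ℳ m) a : M)) h0
  simp only [DirectSum.decompose_sum, DirectSum.sum_apply, DirectSum.decompose_zero,
    AddSubmonoidClass.coe_finsetSum] at h
  rw [Finset.sum_eq_single a] at h
  · rw [DirectSum.decompose_of_mem_same ℳ (hy a ha)] at h
    simpa using h
  · exact fun c hc hca => (DirectSum.decompose_of_mem_ne ℳ (hy c hc) hca)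
  · exact fun h => absurd ha h

/-- The kernel of a homogeneous map is generated by homogeneous elements. -/
lemma ker_le_span {B : Type v} (δ : B → Fin n → ℤ) {N : Type*} [AddCommGroup N] [Module S N]
    (P : (Fin n → ℤ) → Set N) (hP : SumFree P) (g : (B →₀ S) →ₗ[S] N)
    (hg : ∀ a, ∀ x ∈ freePiece K δ a, g x ∈ P a) :
    LinearMap.ker g ≤ Submodule.span S {x | g x = 0 ∧ ∃ a, x ∈ freePiece K δ a} := by
  intro x hx
  have hx' : x ∈ ⨆ a, freePiece K δ a := by rw [iSup_freePiece]; trivial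
  obtain ⟨f, hf, rfl⟩ := (Submodule.mem_iSup_iff_exists_finsupp _ _).1 hx'
  rw [LinearMap.mem_ker, Finsupp.sum, map_sum] at hx
  have h := hP f.support (fun a => g (f a)) (fun a _ => hg a _ (hf a)) hx
  exact Submodule.sum_mem _ fun a ha => Submodule.subset_span ⟨h a ha, a, hf a⟩

/-- A graded free module together with a submodule generated by homogeneous elements. -/
structure Stage (K : Type u) [Field K] (n : ℕ) where
  B : Type (max u v)
  deg : B → Fin n → ℤ
  rel : Submodule (MvPolynomial (Fin n) K) (B →₀ MvPolynomial (Fin n) K)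
  rel_le : rel ≤ Submodule.span _ {x | x ∈ rel ∧ ∃ a, x ∈ freePiece K deg a}

/-- The homogeneous elements of the submodule. -/
def Stage.Gen (s : Stage.{u, v} K n) : Type (max u v) :=
  Σ a : Fin n → ℤ, {x : s.B →₀ S // x ∈ s.rel ∧ x ∈ freePiece K s.deg a}

/-- The map from the free module on the homogeneous elements of the submodule. -/
def Stage.map (s : Stage.{u, v} K n) : (s.Gen →₀ S) →ₗ[S] (s.B →₀ S) :=
  Finsupp.linearCombination S (fun b : s.Gen => b.2.1)

lemma Stage.map_mem (s : Stage.{u, v} K n) (a : Fin n → ℤ) (x : s.Gen →₀ S)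
    (hx : x ∈ freePiece K (fun b : s.Gen => b.1) a) : s.map x ∈ freePiece K s.deg a := by
  rw [Stage.map, Finsupp.linearCombination_apply]
  refine Submodule.sum_mem _ fun b _ c => ?_
  have := mul_mem_polyPiece (hx b) (b.2.2.2 c)
  simpa using this

lemma Stage.range_map (s : Stage.{u, v} K n) : LinearMap.range s.map = s.rel := by
  rw [Stage.map, Finsupp.range_linearCombination]
  apply le_antisymm
  · rw [Submodule.span_le]
    rintro _ ⟨b, rfl⟩
    exact b.2.2.1
  · refine s.rel_le.trans (Submodule.span_mono ?_)
    rintro x ⟨hx, a, ha⟩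
    exact ⟨⟨a, x, hx, ha⟩, rfl⟩

/-- The next step: the free module on the homogeneous elements, with the kernel of the map. -/
def Stage.next (s : Stage.{u, v} K n) : Stage.{u, v} K n where
  B := s.Gen
  deg b := b.1
  rel := LinearMap.ker s.map
  rel_le := ker_le_span _ _ (sumFree_freePiece s.deg) s.map s.map_mem

lemma Stage.exact (s : Stage.{u, v} K n) : Function.Exact s.next.map s.map :=
  LinearMap.exact_iff.2 s.next.range_map.symm

variable {M : Type v} [AddCommGroup M] [Module (MvPolynomial (Fin n) K) M]
  (ℳ : (Fin n → ℤ) → AddSubgroup M)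

/-- The map onto `M` from the graded free module on all homogeneous elements of `M`. -/
def cover : (ULift.{u} (Σ a, ℳ a) →₀ S) →ₗ[S] M :=
  Finsupp.linearCombination S (fun b => (b.down.2 : M))

lemma cover_mem [SetLike.GradedSMul (polyPiece K n) ℳ] (a : Fin n → ℤ)
    (x : ULift.{u} (Σ a, ℳ a) →₀ S) (hx : x ∈ freePiece K (fun b => b.down.1) a) :
    cover ℳ x ∈ ℳ a := by
  rw [cover, Finsupp.linearCombination_apply]
  refine AddSubgroup.sum_mem _ fun b _ => ?_
  have := SetLike.GradedSMul.smul_mem (hx b) b.down.2.2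
  simpa using this

lemma cover_surjective [DirectSum.Decomposition ℳ] :
    Function.Surjective (cover (K := K) ℳ) := by
  classical
  intro m
  rw [← LinearMap.mem_range, ← DirectSum.sum_support_decompose ℳ m]
  refine Submodule.sum_mem _ fun a _ => ?_
  exact ⟨Finsupp.single ⟨a, DirectSum.decompose ℳ m a⟩ 1, by simp [cover]⟩

/-- The stages of the standard resolution. -/
def stage [DirectSum.Decomposition ℳ] [SetLike.GradedSMul (polyPiece K n) ℳ] :
    ℕ → Stage.{u, v} K n
  | 0 => { B := ULift.{u} (Σ a, ℳ a)
           deg := fun b => b.down.1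
           rel := LinearMap.ker (cover ℳ)
           rel_le := ker_le_span _ _ (sumFree_of_decomposition ℳ) (cover ℳ) (cover_mem ℳ) }
  | i + 1 => (stage i).next

lemma exact_cover [DirectSum.Decomposition ℳ] [SetLike.GradedSMul (polyPiece K n) ℳ] :
    Function.Exact (stage (K := K) ℳ 0).map (cover (K := K) ℳ) :=
  LinearMap.exact_iff.2 (stage (K := K) ℳ 0).range_map.symm

end Existence

section Tor

variable (K : Type u) [Field K] {n : ℕ} {M : Type v} [AddCommGroup M]
  [Module (MvPolynomial (Fin n) K) M] (ℳ : (Fin n → ℤ) → AddSubgroup M)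

/-- The standard graded free resolution: `F_0` is free on the homogeneous elements of `M`, and
`F_{i+1}` is free on the homogeneous elements of the kernel of the map leaving `F_i`. -/
def resolution [DirectSum.Decomposition ℳ] [SetLike.GradedSMul (polyPiece K n) ℳ] :
    FreeResolution K n ℳ where
  B i := (stage (K := K) ℳ i).B
  deg i := (stage ℳ i).deg
  aug := cover ℳ
  d i := (stage ℳ i).map
  aug_mem := cover_mem ℳ
  d_mem i := (stage ℳ i).map_mem
  aug_surjective := cover_surjective ℳ
  exact_zero := exact_cover ℳ
  exact_succ i := (stage ℳ i).exact

variable (n) in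
/-- `K` as an `S`-module, i.e. `S / (X_1, …, X_n)`. -/
abbrev ResidueField : Type u :=
  MvPolynomial (Fin n) K ⧸ Ideal.span (Set.range (X : Fin n → MvPolynomial (Fin n) K))

variable {K ℳ}

namespace FreeResolution

variable (F : FreeResolution K n ℳ)

/-- `K ⊗_S F_i`. -/
def reduced (i : ℕ) : Type (max u v) :=
  TensorProduct (MvPolynomial (Fin n) K) (ResidueField K n) (F.B i →₀ MvPolynomial (Fin n) K)

instance (i : ℕ) : AddCommGroup (F.reduced i) :=
  inferInstanceAs (AddCommGroup (TensorProduct (MvPolynomial (Fin n) K) (ResidueField K n)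
    (F.B i →₀ MvPolynomial (Fin n) K)))

instance (i : ℕ) : Module K (F.reduced i) :=
  inferInstanceAs (Module K (TensorProduct (MvPolynomial (Fin n) K) (ResidueField K n)
    (F.B i →₀ MvPolynomial (Fin n) K)))

/-- The map `x ↦ 1 ⊗ x` from `F_i` to `K ⊗_S F_i`. -/
def toReduced (i : ℕ) : (F.B i →₀ MvPolynomial (Fin n) K) →ₗ[K] F.reduced i :=
  (TensorProduct.mk (MvPolynomial (Fin n) K) (ResidueField K n)
    (F.B i →₀ MvPolynomial (Fin n) K) 1).restrictScalars K

/-- The degree `a` piece of `K ⊗_S F_i`: the elements `1 ⊗ x` with `x` homogeneous of degree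
`a`. -/
def reducedPiece (i : ℕ) (a : Fin n → ℤ) : Submodule K (F.reduced i) :=
  (freePiece K (F.deg i) a).map (F.toReduced i)

/-- The differential `K ⊗_S F_{i+1} → K ⊗_S F_i`. -/
def reducedD (i : ℕ) : F.reduced (i + 1) →ₗ[K] F.reduced i :=
  ((F.d i).lTensor (ResidueField K n)).restrictScalars K

/-- The cycles of degree `a` in `K ⊗_S F_i`. -/
def cycles : (i : ℕ) → (a : Fin n → ℤ) → Submodule K (F.reduced i)
  | 0, a => F.reducedPiece 0 a
  | i + 1, a => F.reducedPiece (i + 1) a ⊓ LinearMap.ker (F.reducedD i)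

/-- The boundaries of degree `a` in `K ⊗_S F_i`. -/
def boundaries (i : ℕ) (a : Fin n → ℤ) : Submodule K (F.reduced i) :=
  (F.reducedPiece (i + 1) a).map (F.reducedD i)

/-- The degree `a` piece of the homology `H_i(K ⊗_S F)`. -/
abbrev homology (i : ℕ) (a : Fin n → ℤ) : Type (max u v) :=
  F.cycles i a ⧸ (F.boundaries i a).submoduleOf (F.cycles i a)

end FreeResolution

variable (K ℳ) [DirectSum.Decomposition ℳ] [SetLike.GradedSMul (polyPiece K n) ℳ]

/-- `Tor_i^S(M, K)_a`. -/
abbrev TorPiece (i : ℕ) (a : Fin n → ℤ) : Type (max u v) :=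
  (resolution K ℳ).homology i a

/-- The `ℤ^n`-graded Betti number `β_{i,a}(M) = dim_K Tor_i^S(M, K)_a`, as a cardinal. -/
def multiBetti (i : ℕ) (a : Fin n → ℤ) : Cardinal :=
  Module.rank K (TorPiece K ℳ i a)

/-- The `ℤ`-graded Betti number `β_{i,j}(M)`, the sum of the `β_{i,a}(M)` over `|a| = j`. -/
def betti (i : ℕ) (j : ℤ) : Cardinal :=
  Cardinal.sum fun a : {a : Fin n → ℤ // ∑ l, a l = j} => multiBetti K ℳ i a

/-- The Castelnuovo–Mumford regularity. The set is finite and non-empty for finitely generated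
`M ≠ 0`. -/
def regularity : ℤ :=
  sSup {j : ℤ | ∃ i : ℕ, betti K ℳ i (i + j) ≠ 0}

/-- `d_k(M) = min ({j | β_{k,k+j}(M) ≠ 0} ∪ {reg M})`. -/
def dk (k : ℕ) : ℤ :=
  sInf ({j : ℤ | betti K ℳ k (k + j) ≠ 0} ∪ {regularity K ℳ})

/-- `β_i^{k,lin}(M) = β_{i,i+d_k(M)}(M)`. -/
def linBetti (k i : ℕ) : Cardinal :=
  betti K ℳ i (i + dk K ℳ k)

end Tor

end MultigradedBetti

end

noncomputable section

namespace MultigradedBetti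

universe u v w

/-! Let `G` be a minimal graded free resolution of `M`, with differential ∂, and let c = d_k(M).
Minimal differentials strictly lower the total degree of generators, so every generator of G_i with
i ≥ k has total degree at least i + c (`add_dk_le_of_deg`). On generators of G_i of degree exactly i
+ c, i > k, the differential is therefore linear: ∂e = Σ_j X_j D_j e. Comparing coefficients of X_j
X_l in ∂² = 0 shows that the D_j anticommute and square to zero, so a set U of variables defines an
operator D_U up to sign.

Fix a generator e_β of G_p of degree p + c. A nonzero D_A e_β with |A| = p - i exhibits a generator
of G_i of multidegree deg β - 1_A, and different A give different multidegrees. Each such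
multidegree contributes at least 1 to the Betti number, so only the nonvanishing of multigraded
Betti numbers has to be read off from `G` (`multiBetti_ne_zero_iff`), and it remains to find
binom(p, i) such sets A.

For |U| = p - k put z_U = ∂(D_U e_β) in G_{k-1}. Not all z_U vanish, and ∂² = 0 gives the Koszul
relations Σ_{j ∉ H} ± X_j z_{H ∪ j} = 0. The image of G_k in G_{k-1} is a k-th syzygy module, on
which k variables form a regular sequence (`mem_varIdeal_smul_range`). With minimality this shows
that if |W| < k, v ∉ W and X_v z_U lies in (X_w : w ∈ W) G_{k-1}, then z_U = 0
(`IsMinimal.eq_zero_of_X_smul_eq_sum`). A deletion-link induction on the support of such a cycle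
(`choose_le_card_faces`) yields binom(p, p - i) sets A of size p - i, each inside some U with z_U ≠
0. Then D_A e_β ≠ 0, because D_U is ± D_{U \ A} D_A. -/

/-! ### Combinatorics: faces of the support of a Koszul cycle. -/

open Classical in
/-- Lower bound for the number of faces of the support of a cycle of the Koszul complex, when
the sequences of at most `k` of the `x v` are regular in the sense of `hreg`. -/
theorem choose_le_card_faces {R N V : Type*} [CommRing R] [AddCommGroup N] [Module R N]
    [Fintype V] [DecidableEq V] (x : V → R) (L : Set N) (hL : 0 ∈ L) (k : ℕ)
    (hreg : ∀ (W : Finset V) (v : V) (g : V → N), W.card < k → v ∉ W → ∀ m ∈ L,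
      x v • m = ∑ w ∈ W, x w • g w → m = 0) (t : ℕ) :
    ∀ (q : ℕ) (W : Finset V) (z : Finset V → N), t = q + (k - W.card) → W.card ≤ k →
      (∀ H, z H ∈ L) →
      (∀ H : Finset V, H.card + 1 = q → ∃ ε : V → Rˣ,
        ∑ j ∈ Hᶜ, ε j • x j • z (insert j H) = 0) →
      (∃ G : Finset V, G.card = q ∧ Disjoint G W ∧ z G ≠ 0) → ∀ j ≤ q,
      (q + (k - W.card)).choose j ≤ (Finset.univ.filter fun A : Finset V => A.card = j ∧
        ∃ G : Finset V, A ⊆ G ∧ G.card = q ∧ Disjoint G W ∧ z G ≠ 0).card := by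
  classical
  induction t with
  | zero =>
    rintro q W z ht hW hz hc ⟨G, hG, hGW, hzG⟩ j hj
    obtain rfl : j = 0 := by omega
    rw [Nat.choose_zero_right, Nat.one_le_iff_ne_zero, ← Nat.pos_iff_ne_zero, Finset.card_pos]
    exact ⟨∅, by simpa using ⟨G, hG, hGW, hzG⟩⟩
  | succ t ih =>
    rintro q W z ht hW hz hc ⟨G, hG, hGW, hzG⟩ j hj
    rcases Nat.eq_zero_or_pos j with rfl | hj0
    · rw [Nat.choose_zero_right, Nat.one_le_iff_ne_zero, ← Nat.pos_iff_ne_zero, Finset.card_pos]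
      exact ⟨∅, by simpa using ⟨G, hG, hGW, hzG⟩⟩
    -- When |W| = k the bound is binom(q, j), already attained by the subsets of the single set `G`.
    rcases hW.eq_or_lt with hk | hk
    · rw [hk, Nat.sub_self, add_zero, ← hG, ← Finset.card_powersetCard]
      refine Finset.card_le_card fun A hA => ?_
      rw [Finset.mem_powersetCard] at hA
      simp only [Finset.mem_filter, Finset.mem_univ, true_and]
      exact ⟨hA.2, G, hA.1, rfl, hGW, hzG⟩
    obtain ⟨v, hv⟩ : G.Nonempty := by rw [← Finset.card_pos]; omega
    have hvW : v ∉ W := Finset.disjoint_left.1 hGW hv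
    -- Deletion of v. If z vanished on all q-sets avoiding W ∪ {v}, the relation at G \ {v} would
    -- express x_v z_G through the x_w with w ∈ W, and `hreg` would give z_G = 0.
    have hdel := ih q (insert v W) z (by rw [Finset.card_insert_of_notMem hvW]; omega)
      (by rw [Finset.card_insert_of_notMem hvW]; omega) hz hc (by
        by_contra! hcon
        apply hzG
        obtain ⟨ε, hε⟩ := hc (G.erase v) (by rw [Finset.card_erase_of_mem hv]; omega)
        rw [← Finset.add_sum_erase _ _ (show v ∈ (G.erase v)ᶜ by simp),
          Finset.insert_erase hv] at hε
        refine hreg W v (fun w => -((ε v)⁻¹ • if w ∈ G.erase v then 0 else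
          ε w • z (insert w (G.erase v)))) hk hvW _ (hz G) ?_
        have h1 : ∑ w ∈ ((G.erase v)ᶜ).erase v, ε w • x w • z (insert w (G.erase v)) =
            ∑ w ∈ W, x w • (if w ∈ G.erase v then 0 else ε w • z (insert w (G.erase v))) := by
          refine Finset.sum_congr_of_eq_on_inter ?_ ?_ ?_
          · intro w hw hwW
            simp only [Finset.mem_erase, Finset.mem_compl, not_and] at hw
            rw [hcon (insert w (G.erase v)), smul_zero, smul_zero]
            · rw [Finset.card_insert_of_notMem (by simpa using hw.2),
                Finset.card_erase_of_mem hv]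
              omega
            · rw [Finset.disjoint_insert_left, Finset.disjoint_insert_right]
              refine ⟨by simp [hw.1, hwW], by simp, ?_⟩
              exact hGW.mono_left (Finset.erase_subset _ _)
          · intro w hwW hw
            rw [if_pos, smul_zero]
            by_contra h
            apply hw
            simp only [Finset.mem_erase, Finset.mem_compl]
            exact ⟨fun h' => hvW (h' ▸ hwW), by simpa using h⟩
          · intro w hw _
            simp only [Finset.mem_erase, Finset.mem_compl] at hw
            rw [if_neg (by simpa using hw.2), smul_comm]
        rw [h1] at hε
        have h2 : x v • z G = (ε v)⁻¹ • ε v • x v • z G := by simp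
        rw [h2, eq_neg_of_add_eq_zero_left hε, smul_neg, Finset.smul_sum, ← Finset.sum_neg_distrib]
        exact Finset.sum_congr rfl fun w _ => by rw [smul_neg, smul_comm]) j hj
    -- Link of v. Extending by zero to the sets containing v makes the relations there trivial; the
    -- others are the relations of z at H ∪ {v}.
    have hlink := ih (q - 1) W (fun H => if v ∈ H then 0 else z (insert v H)) (by omega) hW
      (fun H => by split_ifs; exacts [hL, hz _]) (by
        intro H hH
        by_cases hvH : v ∈ H
        · exact ⟨1, Finset.sum_eq_zero fun j _ => by simp [hvH]⟩
        · obtain ⟨ε, hε⟩ := hc (insert v H) (by rw [Finset.card_insert_of_notMem hvH]; omega)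
          refine ⟨ε, ?_⟩
          rw [Finset.compl_insert] at hε
          rw [← Finset.add_sum_erase _ _ (show v ∈ Hᶜ by simpa using hvH),
            if_pos (Finset.mem_insert_self _ _), smul_zero, smul_zero, zero_add]
          refine Eq.trans ?_ hε
          refine Finset.sum_congr rfl fun j hj => ?_
          rw [if_neg, Finset.insert_comm]
          simpa [hvH, eq_comm] using (Finset.mem_erase.1 hj).1) ⟨G.erase v, by
          rw [Finset.card_erase_of_mem hv, hG], hGW.mono_left (Finset.erase_subset _ _), by
          simpa [Finset.insert_erase hv] using hzG⟩ (j - 1) (by omega)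
    have hpas : (q + (k - W.card)).choose j = (q - 1 + (k - W.card)).choose (j - 1) +
        (q + (k - (insert v W).card)).choose j := by
      rw [Finset.card_insert_of_notMem hvW]
      obtain ⟨j, rfl⟩ := Nat.exists_eq_add_of_le' hj0
      obtain ⟨s, hs⟩ : ∃ s, q + (k - W.card) = s + 1 := ⟨_, ht.symm⟩
      rw [hs, Nat.choose_succ_succ, show q - 1 + (k - W.card) = s by omega,
        show q + (k - (W.card + 1)) = s by omega]
      simp
    rw [hpas]
    -- Adding v to the faces of the link gives faces containing v, while those of the deletion avoid
    -- v, so the two counts add.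
    refine (add_le_add hlink hdel).trans ?_
    rw [← Finset.card_image_of_injOn (f := insert v)
      (s := Finset.univ.filter fun A : Finset V => A.card = j - 1 ∧
        ∃ G : Finset V, A ⊆ G ∧ G.card = q - 1 ∧ Disjoint G W ∧
          (if v ∈ G then 0 else z (insert v G)) ≠ 0), ← Finset.card_union_of_disjoint]
    · refine Finset.card_le_card fun A hA => ?_
      simp only [Finset.mem_union, Finset.mem_image, Finset.mem_filter, Finset.mem_univ,
        true_and] at hA ⊢
      rcases hA with ⟨A, ⟨hA, G, hAG, hG, hGW, hzG⟩, rfl⟩ | ⟨hA, G, hAG, hG, hGW, hzG⟩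
      · have hvG : v ∉ G := fun h => hzG (if_pos h)
        rw [if_neg hvG] at hzG
        refine ⟨?_, insert v G, Finset.insert_subset_insert _ hAG, ?_, ?_, hzG⟩
        · rw [Finset.card_insert_of_notMem fun h => hvG (hAG h)]; omega
        · rw [Finset.card_insert_of_notMem hvG]; omega
        · rw [Finset.disjoint_insert_left]; exact ⟨hvW, hGW⟩
      · exact ⟨hA, G, hAG, hG, (Finset.disjoint_insert_right.1 hGW).2, hzG⟩
    · rw [Finset.disjoint_left]
      intro A hA hA'
      simp only [Finset.mem_image, Finset.mem_filter, Finset.mem_univ, true_and] at hA hA'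
      obtain ⟨A, -, rfl⟩ := hA
      obtain ⟨-, G, hAG, -, hGW, -⟩ := hA'
      exact (Finset.disjoint_insert_right.1 hGW).1 (hAG (Finset.mem_insert_self _ _))
    · intro A hA A' hA' h
      simp only [Finset.coe_filter, Finset.mem_univ, true_and, Set.mem_ofPred_eq] at hA hA'
      have aux : ∀ A : Finset V, (∃ G : Finset V, A ⊆ G ∧ G.card = q - 1 ∧ Disjoint G W ∧
          (if v ∈ G then 0 else z (insert v G)) ≠ 0) → v ∉ A := by
        rintro A ⟨G, hAG, -, -, hzG⟩ hvA
        exact hzG (if_pos (hAG hvA))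
      rw [← Finset.erase_insert (aux A hA.2), h, Finset.erase_insert (aux A' hA'.2)]

theorem exists_faces_of_cycle {R N V : Type*} [CommRing R] [AddCommGroup N] [Module R N]
    [Fintype V] [DecidableEq V] (x : V → R) (L : Set N) (hL : 0 ∈ L) (k : ℕ)
    (hreg : ∀ (W : Finset V) (v : V) (g : V → N), W.card < k → v ∉ W → ∀ m ∈ L,
      x v • m = ∑ w ∈ W, x w • g w → m = 0) (q : ℕ) (z : Finset V → N) (hz : ∀ H, z H ∈ L)
    (hc : ∀ H : Finset V, H.card + 1 = q → ∃ ε : V → Rˣ,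
      ∑ j ∈ Hᶜ, ε j • x j • z (insert j H) = 0)
    (hne : ∃ G : Finset V, G.card = q ∧ z G ≠ 0) {j : ℕ} (hj : j ≤ q) :
    ∃ F : Finset (Finset V), (q + k).choose j ≤ F.card ∧
      ∀ A ∈ F, A.card = j ∧ ∃ G, A ⊆ G ∧ z G ≠ 0 := by
  have h := choose_le_card_faces x L hL k hreg _ q ∅ z rfl (by simp) hz hc
    (by simpa using hne) j hj
  rw [Finset.card_empty, Nat.sub_zero] at h
  refine ⟨_, h, fun A hA => ?_⟩
  simp only [Finset.mem_filter, Finset.mem_univ, true_and] at hA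
  obtain ⟨hA, G, hAG, -, -, hzG⟩ := hA
  exact ⟨hA, G, hAG, hzG⟩

/-! ### Regularity of variables on syzygy modules. -/

section Regular

variable {K : Type u} [Field K] {n : ℕ}

local notation "S" => MvPolynomial (Fin n) K

/-- The ideal generated by a set of variables. -/
def varIdeal (K : Type u) [Field K] {n : ℕ} (W : Set (Fin n)) : Ideal (MvPolynomial (Fin n) K) :=
  Ideal.span (X '' W)

lemma mem_ideal_smul_top_iff {R B : Type*} [CommRing R] (I : Ideal R) (f : B →₀ R) :
    f ∈ I • (⊤ : Submodule R (B →₀ R)) ↔ ∀ b, f b ∈ I := by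
  constructor
  · intro hf b
    have h := Submodule.mem_map_of_mem (f := Finsupp.lapply (R := R) b) hf
    rw [Submodule.map_smul''] at h
    simpa using Submodule.smul_le.2 (fun r hr s _ => I.mul_mem_right s hr) h
  · intro hf
    rw [← Finsupp.sum_single f]
    refine Submodule.sum_mem _ fun b _ => ?_
    have : Finsupp.single b (f b) = f b • Finsupp.single b (1 : R) := by simp
    rw [this]
    exact Submodule.smul_mem_smul (hf b) trivial

lemma mem_varIdeal_of_X_mul_mem {W : Set (Fin n)} {v : Fin n} (hv : v ∉ W) {p : S}
    (hp : X v * p ∈ varIdeal K W) : p ∈ varIdeal K W := by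
  rw [varIdeal, mem_ideal_span_X_image] at hp ⊢
  intro m hm
  obtain ⟨i, hi, h⟩ := hp (Finsupp.single v 1 + m) (by
    rw [mem_support_iff, coeff_X_mul]; exact mem_support_iff.1 hm)
  refine ⟨i, hi, ?_⟩
  have : v ≠ i := fun h => hv (h ▸ hi)
  simpa [Finsupp.single_apply, this] using h

lemma varIdeal_insert (v : Fin n) (W : Set (Fin n)) :
    varIdeal K (insert v W) = Ideal.span {X v} ⊔ varIdeal K W := by
  rw [varIdeal, Set.image_insert_eq, Ideal.span_insert]; rfl

lemma mem_varIdeal_smul_of_X_smul_mem_top {B : Type*} {W : Set (Fin n)} {v : Fin n} (hv : v ∉ W)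
    {f : B →₀ S} (hf : (X v : S) • f ∈ varIdeal K W • (⊤ : Submodule S (B →₀ S))) :
    f ∈ varIdeal K W • (⊤ : Submodule S (B →₀ S)) := by
  rw [mem_ideal_smul_top_iff] at hf ⊢
  exact fun b => mem_varIdeal_of_X_mul_mem hv (hf b)

/-- Sequences of at most `i + 1` variables are regular on an `(i + 1)`-st syzygy module. -/
theorem mem_varIdeal_smul_range {B : ℕ → Type*}
    (d : ∀ i, (B (i + 1) →₀ S) →ₗ[S] (B i →₀ S)) (hd : ∀ i, Function.Exact (d (i + 1)) (d i)) :
    ∀ (i : ℕ) (W : Finset (Fin n)), W.card ≤ i →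
      LinearMap.range (d i) ⊓ varIdeal K (W : Set (Fin n)) • ⊤ ≤
        varIdeal K (W : Set (Fin n)) • LinearMap.range (d i) := by
  intro i
  induction i with
  | zero =>
    intro W hW
    obtain rfl : W = ∅ := by simpa using hW
    simp [varIdeal]
  | succ i ih =>
    intro W
    induction W using Finset.induction_on with
    | empty => simp [varIdeal]
    | insert v W hv ihW =>
      rw [Finset.card_insert_of_notMem hv, Finset.coe_insert, varIdeal_insert]
      rintro hW m ⟨hm, hmI⟩
      rw [Submodule.sup_smul, Submodule.ideal_span_singleton_smul] at hmI
      obtain ⟨_, ⟨g, -, rfl⟩, w, hw, rfl⟩ := Submodule.mem_sup.1 hmI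
      change (X v : S) • g + w ∈ _ at hm
      change (X v : S) • g + w ∈ _
      have hmap : ∀ y ∈ varIdeal K (W : Set (Fin n)) • (⊤ : Submodule S (B (i + 1) →₀ S)),
          d i y ∈ varIdeal K (W : Set (Fin n)) • LinearMap.range (d i) := by
        intro y hy
        have := Submodule.mem_map_of_mem (f := d i) hy
        rwa [Submodule.map_smul'', Submodule.map_top] at this
      -- Applying `d i` to m = X_v g + w puts X_v · d g into I_W · range (d i). As X_v is a
      -- nonzerodivisor modulo I_W, the case `i` replaces g by some h in I_W F with the same image.
      -- Then g - h is in the range of `d (i + 1)`, and the remainder X_v h + w is handled by the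
      -- smaller set W.
      have h0 : d i ((X v : S) • g + w) = 0 := (hd i _).2 hm
      have h1 : (X v : S) • d i g ∈ varIdeal K (W : Set (Fin n)) • LinearMap.range (d i) := by
        rw [map_add, map_smul] at h0
        rw [eq_neg_of_add_eq_zero_left h0]
        exact Submodule.neg_mem _ (hmap w hw)
      have h2 : d i g ∈ varIdeal K (W : Set (Fin n)) • LinearMap.range (d i) :=
        ih W (by omega) ⟨⟨g, rfl⟩, mem_varIdeal_smul_of_X_smul_mem_top (by simpa using hv)
          (Submodule.smul_mono le_rfl le_top h1)⟩
      rw [← Submodule.map_top, ← Submodule.map_smul''] at h2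
      obtain ⟨h, hh, hdh⟩ := h2
      have h3 : g - h ∈ LinearMap.range (d (i + 1)) := (hd i _).1 (by rw [map_sub, hdh, sub_self])
      have h4 : (X v : S) • h + w ∈
          varIdeal K (W : Set (Fin n)) • LinearMap.range (d (i + 1)) := by
        refine ihW (by omega) ⟨?_, Submodule.add_mem _ (Submodule.smul_mem _ _ hh) hw⟩
        have := Submodule.sub_mem _ hm (Submodule.smul_mem _ (X v : S) h3)
        rwa [show (X v : S) • g + w - (X v : S) • (g - h) = (X v : S) • h + w by
          rw [smul_sub]; abel] at this
      rw [Submodule.sup_smul]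
      have h5 : (X v : S) • g + w = (X v : S) • (g - h) + ((X v : S) • h + w) := by
        rw [smul_sub]; abel
      rw [h5]
      exact Submodule.add_mem_sup
        (Submodule.smul_mem_smul (Ideal.mem_span_singleton_self _) h3) h4

end Regular

/-! ### Coefficient vectors in free modules. -/

section Coefficients

variable {K : Type u} [Field K] {n : ℕ}

local notation "S" => MvPolynomial (Fin n) K

lemma eq_of_coeff_ne_zero {a : Fin n → ℤ} {p : S} (hp : p ∈ polyPiece K n a) {m : Fin n →₀ ℕ}
    (hm : coeff m p ≠ 0) : (fun i => (m i : ℤ)) = a := by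
  rw [← hp hm, Finsupp.weight_apply, Finsupp.sum_fintype _ _ (by simp)]
  ext i
  simp [Finset.sum_apply, Pi.single_apply]

lemma X_mem_polyPiece (j : Fin n) : (X j : S) ∈ polyPiece K n (Pi.single j 1) :=
  isWeightedHomogeneous_X K _ j

lemma C_mem_polyPiece (c : K) : (C c : S) ∈ polyPiece K n 0 :=
  isWeightedHomogeneous_C _ c

variable (K) in
/-- The constant vectors in a free module. -/
def const {B : Type*} : (B →₀ K) →ₗ[K] (B →₀ S) :=
  Finsupp.mapRange.linearMap (Algebra.linearMap K S)

/-- The vector of the coefficients of a given monomial. -/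
def coef {B : Type*} (m : Fin n →₀ ℕ) : (B →₀ S) →ₗ[K] (B →₀ K) :=
  Finsupp.mapRange.linearMap (lcoeff K m)

@[simp] lemma const_apply {B : Type*} (v : B →₀ K) (b : B) :
    (const K v : B →₀ S) b = C (v b) := rfl

@[simp] lemma coef_apply {B : Type*} (m : Fin n →₀ ℕ) (f : B →₀ S) (b : B) :
    coef m f b = coeff m (f b) := rfl

@[simp] lemma const_single {B : Type*} (b : B) (c : K) :
    (const K (Finsupp.single b c) : B →₀ S) = Finsupp.single b (C c) := by
  simp [const]

@[simp] lemma coef_zero_const {B : Type*} (v : B →₀ K) : coef 0 (const K v : B →₀ S) = v := by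
  ext b; simp

/-- The coefficients of the image under a linear map. -/
lemma coef_map {B B' : Type*} (d : (B →₀ S) →ₗ[S] (B' →₀ S)) (m : Fin n →₀ ℕ) (f : B →₀ S) :
    coef m (d f) = ∑ x ∈ Finset.HasAntidiagonal.antidiagonal m, coef x.2 (d (const K (coef x.1 f))) := by
  induction f using Finsupp.induction_linear with
  | zero => simp
  | add f g hf hg => simp only [map_add, hf, hg, Finset.sum_add_distrib]
  | single b p =>
    ext c
    have h1 : ∀ q : S, Finsupp.single b q = q • Finsupp.single b (1 : S) := by simp
    have h2 : ∀ u, (const K (coef u (Finsupp.single b p)) : B →₀ S) =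
        Finsupp.single b (C (coeff u p)) := by
      intro u
      rw [← const_single]
      simp [coef]
    simp only [h2]
    simp only [Finsupp.finsetSum_apply, coef_apply]
    rw [h1, map_smul, Finsupp.smul_apply, smul_eq_mul, coeff_mul]
    refine Finset.sum_congr rfl fun x _ => ?_
    rw [h1 (C _), map_smul, Finsupp.smul_apply, smul_eq_mul, coeff_C_mul]

lemma eq_single_of_degree_eq_one {m : Fin n →₀ ℕ} (hm : ∑ i, m i = 1) :
    ∃ j, m = Finsupp.single j 1 := by
  obtain ⟨j, -, hj⟩ : ∃ j ∈ Finset.univ, m j ≠ 0 := by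
    by_contra! h
    rw [Finset.sum_eq_zero h] at hm
    omega
  refine ⟨j, ?_⟩
  rw [← Finset.add_sum_erase _ _ (Finset.mem_univ j)] at hm
  have h0 : ∑ i ∈ Finset.univ.erase j, m i = 0 := by omega
  ext i
  by_cases h : j = i
  · subst h; rw [Finsupp.single_eq_same]; omega
  · rw [Finsupp.single_eq_of_ne' h]
    exact Finset.sum_eq_zero_iff.1 h0 i (by simp [Ne.symm h])

/-- A vector of linear forms is determined by its linear coefficients. -/
lemma eq_sum_of_linear {B : Type*} {f : B →₀ S}
    (hf : ∀ b m, coeff m (f b) ≠ 0 → ∑ i, m i = 1) :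
    f = ∑ j, (X j : S) • const K (coef (Finsupp.single j 1) f) := by
  classical
  ext b m
  simp only [Finsupp.finsetSum_apply, Finsupp.smul_apply, const_apply, coef_apply, smul_eq_mul,
    coeff_sum]
  have h2 : ∀ j, coeff m (X j * C (coeff (Finsupp.single j 1) (f b)) : S) =
      if Finsupp.single j 1 = m then coeff m (f b) else 0 := by
    intro j
    rw [mul_comm, coeff_C_mul, coeff_X]
    split_ifs with h
    · rw [h, mul_one]
    · rw [mul_zero]
  simp only [h2]
  by_cases h : coeff m (f b) = 0
  · simp [h]
  · obtain ⟨j, rfl⟩ := eq_single_of_degree_eq_one (hf b m h)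
    rw [Finset.sum_eq_single j]
    · simp
    · intro i _ hij
      rw [if_neg]
      simpa [Finsupp.single_left_inj] using hij
    · simp

end Coefficients

/-! ### The anticommuting operators given by the linear part of a minimal resolution. -/

namespace FreeResolution

variable {K : Type u} [Field K] {n : ℕ} {M : Type v} [AddCommGroup M]
  [Module (MvPolynomial (Fin n) K) M] {ℳ : (Fin n → ℤ) → AddSubgroup M}

local notation "S" => MvPolynomial (Fin n) K

variable (G : FreeResolution K n ℳ)

/-- A resolution is minimal if its differentials have no constant coefficients. -/
def IsMinimal : Prop := ∀ i x, coef 0 (G.d i x) = 0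

variable {G} in
lemma IsMinimal.coef_eq_zero_of_d_eq_zero (h : G.IsMinimal) {i : ℕ} {x : G.B (i + 1) →₀ S}
    (hx : G.d i x = 0) : coef 0 x = 0 := by
  obtain ⟨y, rfl⟩ := (G.exact_succ i x).1 hx
  exact h _ _

variable {G} in
-- A constant vector killed by the differential would be a boundary, and boundaries have no constant
-- terms.
lemma IsMinimal.d_const_ne_zero (h : G.IsMinimal) {i : ℕ} {v : G.B (i + 1) →₀ K}
    (hv : v ≠ 0) : G.d i (const K v) ≠ 0 := fun h0 => hv <| by
  simpa using h.coef_eq_zero_of_d_eq_zero h0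

lemma d_d (i : ℕ) (x : G.B (i + 1 + 1) →₀ S) : G.d i (G.d (i + 1) x) = 0 :=
  (G.exact_succ i _).2 ⟨x, rfl⟩

lemma single_mem_freePiece {B : Type*} (δ : B → Fin n → ℤ) (b : B) :
    (Finsupp.single b (1 : S)) ∈ freePiece K δ (δ b) := by
  intro c
  by_cases h : b = c
  · subst h
    rw [Finsupp.single_eq_same, sub_self, ← C_1]
    exact C_mem_polyPiece 1
  · rw [Finsupp.single_eq_of_ne' h]
    exact Submodule.zero_mem _

lemma eq_of_coeff_d_ne_zero {i : ℕ} {v : G.B (i + 1) →₀ K} {b : G.B i} {m : Fin n →₀ ℕ}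
    (h : coeff m (G.d i (const K v) b) ≠ 0) :
    ∃ β, v β ≠ 0 ∧ G.deg i b + (fun l => (m l : ℤ)) = G.deg (i + 1) β := by
  have hv : (const K v : G.B (i + 1) →₀ S) = v.sum fun β c => (C c : S) • Finsupp.single β (1 : S) := by
    conv_lhs => rw [← Finsupp.sum_single v]
    rw [map_finsuppSum]
    simp
  rw [hv, map_finsuppSum, Finsupp.sum, Finsupp.finsetSum_apply, coeff_sum] at h
  obtain ⟨β, hβ, h⟩ := Finset.exists_ne_zero_of_sum_ne_zero h
  refine ⟨β, Finsupp.mem_support_iff.1 hβ, ?_⟩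
  rw [map_smul, Finsupp.smul_apply, smul_eq_mul, coeff_C_mul] at h
  rw [eq_of_coeff_ne_zero (G.d_mem i _ _ (single_mem_freePiece _ β) b) (right_ne_zero_of_mul h)]
  abel

/-- The coefficients of `X_j` in the differentials. -/
def shift (j : Fin n) : Module.End K (∀ i, G.B i →₀ K) :=
  LinearMap.pi fun i => coef (Finsupp.single j 1) ∘ₗ (G.d i).restrictScalars K ∘ₗ const K ∘ₗ
    LinearMap.proj (i + 1)

lemma shift_apply (j : Fin n) (v : ∀ i, G.B i →₀ K) (i : ℕ) :
    G.shift j v i = coef (Finsupp.single j 1) (G.d i (const K (v (i + 1)))) := rfl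

lemma sum_antidiagonal (v : ∀ i, G.B i →₀ K) (i : ℕ)
    (m : Fin n →₀ ℕ) : ∑ x ∈ Finset.HasAntidiagonal.antidiagonal m, coef x.2 (G.d i (const K
      (coef x.1 (G.d (i + 1) (const K (v (i + 2))))))) = 0 := by
  rw [← coef_map, G.d_d, map_zero]

variable {G} in
-- This is the coefficient of X_j X_l in ∂² = 0; splittings of the monomial with a factor 1 drop out
-- by minimality. Summing over a set also covers j = l, where the pair collapses to one term, so
-- that D_j² = 0 holds in characteristic 2 as well.
lemma IsMinimal.sum_subset (h : G.IsMinimal) (v : ∀ i, G.B i →₀ K) (i : ℕ) (j l : Fin n)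
    (s : Finset ((Fin n →₀ ℕ) × (Fin n →₀ ℕ)))
    (hs : s = {(Finsupp.single j 1, Finsupp.single l 1), (Finsupp.single l 1, Finsupp.single j 1)}) :
    ∑ x ∈ s, coef x.2 (G.d i (const K (coef x.1 (G.d (i + 1) (const K (v (i + 2))))))) = 0 := by
  rw [← G.sum_antidiagonal v i (Finsupp.single j 1 + Finsupp.single l 1)]
  refine Finset.sum_subset ?_ ?_
  · subst hs
    intro x hx
    rw [Finset.mem_insert, Finset.mem_singleton] at hx
    rw [Finset.HasAntidiagonal.mem_antidiagonal]
    rcases hx with rfl | rfl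
    · rfl
    · exact add_comm _ _
  · rintro ⟨a, b⟩ hx hxs
    by_cases ha : a = 0
    · simp [ha, h (i + 1)]
    by_cases hb : b = 0
    · simp only [hb, h i]
    exfalso
    rw [Finset.HasAntidiagonal.mem_antidiagonal] at hx
    have hsum : ∑ t, a t + ∑ t, b t = 2 := by
      rw [← Finset.sum_add_distrib]
      have : ∀ t, a t + b t = (Finsupp.single j 1 + Finsupp.single l 1 : Fin n →₀ ℕ) t :=
        fun t => by rw [← hx]; rfl
      simp [this, Finset.sum_add_distrib, Finsupp.single_apply]
    have hpos : ∀ a : Fin n →₀ ℕ, a ≠ 0 → 0 < ∑ t, a t := by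
      intro a ha
      rw [Nat.pos_iff_ne_zero]
      intro h0
      exact ha (Finsupp.ext fun t => Finset.sum_eq_zero_iff.1 h0 t (Finset.mem_univ _))
    have h1 := hpos a ha
    have h2 := hpos b hb
    obtain ⟨a, rfl⟩ := eq_single_of_degree_eq_one (show ∑ t, a t = 1 by omega)
    obtain ⟨b, rfl⟩ := eq_single_of_degree_eq_one (show ∑ t, b t = 1 by omega)
    rw [Finsupp.single_add_single_eq_single_add_single one_ne_zero one_ne_zero] at hx
    apply hxs
    subst hs
    rcases hx with ⟨rfl, rfl⟩ | ⟨-, rfl, rfl⟩ | ⟨h, -⟩ <;> simp_all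

variable {G} in
lemma IsMinimal.shift_shift_self (h : G.IsMinimal) (j : Fin n) (v : ∀ i, G.B i →₀ K) (i : ℕ) :
    G.shift j (G.shift j v) i = 0 := by
  have := h.sum_subset v i j j {(Finsupp.single j 1, Finsupp.single j 1)} (by simp)
  rwa [Finset.sum_singleton] at this

variable {G} in
lemma IsMinimal.shift_shift (h : G.IsMinimal) (j l : Fin n) (v : ∀ i, G.B i →₀ K) (i : ℕ) :
    G.shift j (G.shift l v) i = -G.shift l (G.shift j v) i := by
  by_cases hjl : j = l
  · subst hjl; rw [h.shift_shift_self, neg_zero]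
  have := h.sum_subset v i j l _ rfl
  rw [Finset.sum_pair (by simp [Finsupp.single_left_inj, hjl]), add_comm] at this
  exact eq_neg_of_add_eq_zero_left this

/-- The composition of the operators along a word. -/
def word (w : List (Fin n)) : Module.End K (∀ i, G.B i →₀ K) := (w.map G.shift).prod

@[simp] lemma word_nil : G.word [] = 1 := rfl

lemma word_cons (j : Fin n) (w : List (Fin n)) (v : ∀ i, G.B i →₀ K) :
    G.word (j :: w) v = G.shift j (G.word w v) := by simp [word]

lemma word_append (w w' : List (Fin n)) (v : ∀ i, G.B i →₀ K) :
    G.word (w ++ w') v = G.word w (G.word w' v) := by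
  simp [word]

variable {G} in
-- The sign of the permutation is not tracked: later arguments use only nonvanishing, or absorb
-- signs into units.
lemma IsMinimal.word_perm (h : G.IsMinimal) {w w' : List (Fin n)} (hw : w.Perm w')
    (v : ∀ i, G.B i →₀ K) (i : ℕ) :
    G.word w v i = G.word w' v i ∨ G.word w v i = -G.word w' v i := by
  induction hw generalizing i with
  | nil => exact Or.inl rfl
  | cons j _ ih =>
    rw [word_cons, word_cons, shift_apply, shift_apply]
    exact (ih (i + 1)).imp (fun ih => by rw [ih]) (fun ih => by rw [ih]; simp only [map_neg])
  | swap j l w =>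
    right
    rw [word_cons, word_cons, word_cons, word_cons, h.shift_shift]
  | trans _ _ ih ih' =>
    rcases ih i with ih | ih <;> rcases ih' i with ih' | ih' <;> simp [ih, ih']

variable {G} in
lemma IsMinimal.word_ne_zero_of_perm (h : G.IsMinimal) {w w' : List (Fin n)} (hw : w.Perm w')
    {v : ∀ i, G.B i →₀ K} {i : ℕ} (hv : G.word w v i ≠ 0) : G.word w' v i ≠ 0 := by
  intro h0
  apply hv
  rcases h.word_perm hw v i with h | h <;> simp [h, h0]

variable {G} in
lemma IsMinimal.word_cons_eq_zero (h : G.IsMinimal) {j : Fin n} {w : List (Fin n)} (hj : j ∈ w)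
    (v : ∀ i, G.B i →₀ K) (i : ℕ) : G.word (j :: w) v i = 0 := by
  rw [word_cons, shift_apply]
  have h1 := h.shift_shift_self j (G.word (w.erase j) v) i
  rw [← G.word_cons, shift_apply] at h1
  rcases h.word_perm (List.perm_cons_erase hj) v (i + 1) with hε | hε
  · rw [hε, h1]
  · rw [hε]; simp only [map_neg, h1, neg_zero]

variable {G} in
lemma IsMinimal.nodup_of_word_ne_zero (h : G.IsMinimal) {w : List (Fin n)}
    {v : ∀ i, G.B i →₀ K} {i : ℕ} (hw : G.word w v i ≠ 0) : w.Nodup := by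
  induction w generalizing i with
  | nil => exact List.nodup_nil
  | cons j w ih =>
    refine List.nodup_cons.2 ⟨fun hj => hw (h.word_cons_eq_zero hj v i), ih (i := i + 1) fun h0 => ?_⟩
    rw [word_cons, shift_apply, h0] at hw
    simp at hw

/-- Each letter j lowers the homological degree by one and the multidegree by the j-th basis vector.
-/
lemma eq_of_word_ne_zero {p : ℕ} (β : G.B p) (w : List (Fin n)) {i : ℕ} {b : G.B i}
    (hb : G.word w (Pi.single p (Finsupp.single β 1)) i b ≠ 0) :
    i + w.length = p ∧
      G.deg i b + (w.map fun j => (Pi.single j 1 : Fin n → ℤ)).sum = G.deg p β := by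
  classical
  induction w generalizing i b with
  | nil =>
    obtain rfl : i = p := by
      by_contra hip
      simp [Pi.single_eq_of_ne hip] at hb
    simp only [word_nil, Module.End.one_apply, Pi.single_eq_same, Finsupp.single_apply] at hb
    obtain rfl : β = b := by
      by_contra hbβ
      simp [hbβ] at hb
    simp
  | cons j w ih =>
    rw [word_cons, shift_apply, coef_apply] at hb
    obtain ⟨γ, hγ, h⟩ := G.eq_of_coeff_d_ne_zero hb
    obtain ⟨h1, h2⟩ := ih hγ
    refine ⟨by rw [List.length_cons]; omega, ?_⟩
    rw [List.map_cons, List.sum_cons, ← add_assoc, ← h2, ← h]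
    congr 2
    ext l
    simp [Finsupp.single_apply, Pi.single_apply, eq_comm]

variable {G} in
/-- In the lowest degree the differential is given by its linear coefficients. -/
lemma IsMinimal.d_const_eq_sum (h : G.IsMinimal) {i : ℕ} {c : ℤ}
    (hc : ∀ b : G.B i, c ≤ ∑ l, G.deg i b l) (v : ∀ i, G.B i →₀ K)
    (hv : ∀ b, v (i + 1) b ≠ 0 → ∑ l, G.deg (i + 1) b l = c + 1) :
    G.d i (const K (v (i + 1))) = ∑ j, (X j : S) • const K (G.shift j v i) := by
  refine eq_sum_of_linear fun b m hm => ?_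
  obtain ⟨β, hβ, hβm⟩ := G.eq_of_coeff_d_ne_zero hm
  have h1 := hv β hβ
  rw [← hβm] at h1
  simp only [Pi.add_apply, Finset.sum_add_distrib] at h1
  have h2 := hc b
  have h3 : ∑ l, m l ≠ 0 := by
    intro h0
    obtain rfl : m = 0 := Finsupp.ext fun l => Finset.sum_eq_zero_iff.1 h0 l (Finset.mem_univ _)
    exact hm (DFunLike.congr_fun (h i (const K (v (i + 1)))) b)
  have h4 : (∑ l, (m l : ℤ)) = ((∑ l, m l : ℕ) : ℤ) := by push_cast; rfl
  rw [h4] at h1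
  omega

end FreeResolution

/-! ### The lowest linear strand and its multidegrees. -/

namespace FreeResolution

variable {K : Type u} [Field K] {n : ℕ} {M : Type v} [AddCommGroup M]
  [Module (MvPolynomial (Fin n) K) M] {ℳ : (Fin n → ℤ) → AddSubgroup M}

local notation "S" => MvPolynomial (Fin n) K

variable {G : FreeResolution K n ℳ}

lemma coef_zero_eq_zero_of_mem_varIdeal_smul {B : Type*} {W : Set (Fin n)} {f : B →₀ S}
    (hf : f ∈ varIdeal K W • (⊤ : Submodule S (B →₀ S))) : coef 0 f = 0 := by
  rw [mem_ideal_smul_top_iff] at hf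
  ext b
  by_contra h
  obtain ⟨i, -, hi⟩ := mem_ideal_span_X_image.1 (hf b) 0 (mem_support_iff.2 h)
  exact hi rfl

/-- By regularity ∂y = ∂u with u in I_W · G_{k+1}. Then y - u is a cycle, so it has no constant
terms; neither does u, hence the constant vector y is zero. -/
lemma IsMinimal.eq_zero_of_X_smul_eq_sum (h : G.IsMinimal) {k : ℕ} {W : Finset (Fin n)}
    (hW : W.card ≤ k) {v : Fin n} (hv : v ∉ W) (y : G.B (k + 1) →₀ K)
    (g : Fin n → (G.B k →₀ S))
    (hg : (X v : S) • G.d k (const K y) = ∑ w ∈ W, (X w : S) • g w) :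
    G.d k (const K y) = 0 := by
  have h1 : G.d k (const K y) ∈ varIdeal K (W : Set (Fin n)) • LinearMap.range (G.d k) := by
    refine mem_varIdeal_smul_range G.d G.exact_succ k W hW ⟨⟨_, rfl⟩, ?_⟩
    refine mem_varIdeal_smul_of_X_smul_mem_top (v := v) (by simpa using hv) ?_
    rw [hg]
    exact Submodule.sum_mem _ fun w hw =>
      Submodule.smul_mem_smul (Ideal.subset_span ⟨w, hw, rfl⟩) trivial
  rw [← Submodule.map_top, ← Submodule.map_smul''] at h1
  obtain ⟨u, hu, hdu⟩ := h1
  have h2 := h.coef_eq_zero_of_d_eq_zero (x := const K y - u) (by rw [map_sub, hdu, sub_self])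
  rw [map_sub, coef_zero_const, coef_zero_eq_zero_of_mem_varIdeal_smul hu, sub_zero] at h2
  rw [h2, map_zero, map_zero]

lemma sum_list_single (w : List (Fin n)) :
    ∑ l, ((w.map fun j => (Pi.single j 1 : Fin n → ℤ)).sum) l = w.length := by
  induction w with
  | nil => simp
  | cons j w ih =>
    simp only [List.map_cons, List.sum_cons, Pi.add_apply, Finset.sum_add_distrib, ih,
      List.length_cons]
    rw [Finset.sum_pi_single']
    simp [add_comm]

lemma sum_toList_single (A : Finset (Fin n)) :
    (A.toList.map fun j => (Pi.single j 1 : Fin n → ℤ)).sum = fun l => if l ∈ A then 1 else 0 := by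
  rw [Finset.sum_map_toList]
  ext l
  simp [Finset.sum_apply, Pi.single_apply]

lemma toList_perm_append {V : Type*} [DecidableEq V] {A U : Finset V} (hAU : A ⊆ U) :
    U.toList.Perm ((U \ A).toList ++ A.toList) := by
  rw [List.perm_ext_iff_of_nodup U.nodup_toList]
  · intro a
    simp only [Finset.mem_toList, List.mem_append, Finset.mem_sdiff]
    have := @hAU a
    tauto
  · refine List.Nodup.append (Finset.nodup_toList _) (Finset.nodup_toList _) ?_
    intro a h1 h2
    simp_all

section LowestStrand

variable {k p : ℕ} {c : ℤ} {β : G.B p}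

lemma sum_deg_of_word_ne_zero (hβ : ∑ l, G.deg p β l = p + c) {w : List (Fin n)} {i : ℕ}
    {b : G.B i} (hb : G.word w (Pi.single p (Finsupp.single β 1)) i b ≠ 0) :
    ∑ l, G.deg i b l = i + c := by
  obtain ⟨h1, h2⟩ := G.eq_of_word_ne_zero β w hb
  rw [← h2] at hβ
  simp only [Pi.add_apply, Finset.sum_add_distrib, sum_list_single] at hβ
  omega

/-- A nonzero constant vector u in the strand has ∂u = Σ_j X_j D_j u ≠ 0, so some D_j u survives.
The descent stops in homological degree k because linearity needs the degree bound on the target. -/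
lemma IsMinimal.exists_word_ne_zero (h : G.IsMinimal)
    (hc : ∀ i, k ≤ i → ∀ b : G.B i, i + c ≤ ∑ l, G.deg i b l)
    (hβ : ∑ l, G.deg p β l = p + c) (r : ℕ) :
    k + r ≤ p → ∃ w : List (Fin n), w.length = r ∧
      G.word w (Pi.single p (Finsupp.single β 1)) (p - r) ≠ 0 := by
  induction r with
  | zero => exact fun _ => ⟨[], rfl, by simp⟩
  | succ r ih =>
    intro hr
    obtain ⟨w, hw, hne⟩ := ih (by omega)
    obtain ⟨i, hi⟩ : ∃ i, p - r = i + 1 := ⟨p - r - 1, by omega⟩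
    rw [hi] at hne
    have h1 := h.d_const_ne_zero hne
    rw [h.d_const_eq_sum (c := i + c) (hc i (by omega)) _ (fun b hb => by
      rw [sum_deg_of_word_ne_zero hβ hb]; push_cast; ring)] at h1
    obtain ⟨j, -, hj⟩ := Finset.exists_ne_zero_of_sum_ne_zero h1
    refine ⟨j :: w, by rw [List.length_cons, hw], fun h0 => hj ?_⟩
    rw [show p - (r + 1) = i by omega, word_cons] at h0
    rw [h0, map_zero, smul_zero]

/-- The relation is ∂∂(D_H e_β) = 0 with the inner ∂ written linearly. Terms with j ∈ H vanish since
D_j² = 0, and the units ε_j are the signs of moving j to the front. -/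
lemma IsMinimal.exists_sum_smul_eq_zero (h : G.IsMinimal)
    (hc : ∀ b : G.B (k + 1), (k + 1 : ℕ) + c ≤ ∑ l, G.deg (k + 1) b l)
    (hβ : ∑ l, G.deg p β l = p + c) (H : Finset (Fin n)) :
    ∃ ε : Fin n → Sˣ, ∑ j ∈ Hᶜ, ε j • (X j : S) • G.d k (const K (G.word (insert j H).toList
      (Pi.single p (Finsupp.single β 1)) (k + 1))) = 0 := by
  set x : ∀ i, G.B i →₀ K := Pi.single p (Finsupp.single β 1) with hx
  have hε : ∀ j, ∃ ε : Sˣ, j ∉ H →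
      ε • (X j : S) • G.d k (const K (G.word (insert j H).toList x (k + 1))) =
        (X j : S) • G.d k (const K (G.word (j :: H.toList) x (k + 1))) := by
    intro j
    by_cases hj : j ∈ H
    · exact ⟨1, fun h => absurd hj h⟩
    rcases h.word_perm (Finset.toList_insert hj) x (k + 1) with hw | hw
    · exact ⟨1, fun _ => by rw [hw, one_smul]⟩
    · refine ⟨-1, fun _ => ?_⟩
      rw [hw, Units.smul_def, map_neg, map_neg]
      simp
  choose ε hε using hε
  refine ⟨ε, ?_⟩
  rw [Finset.sum_congr rfl fun j hj => hε j (by simpa using hj)]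
  have h1 : ∑ j ∈ Hᶜ, (X j : S) • G.d k (const K (G.word (j :: H.toList) x (k + 1))) =
      ∑ j, (X j : S) • G.d k (const K (G.word (j :: H.toList) x (k + 1))) := by
    refine Finset.sum_subset (Finset.subset_univ _) fun j _ hj => ?_
    rw [h.word_cons_eq_zero (by simpa using hj), map_zero, map_zero, smul_zero]
  rw [h1]
  have h2 := h.d_const_eq_sum (c := (k + 1 : ℕ) + c) hc
    (G.word H.toList x) (fun b hb => by
      rw [sum_deg_of_word_ne_zero hβ hb]; push_cast; ring)
  have h3 := G.d_d k (const K (G.word H.toList x (k + 1 + 1)))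
  rw [h2, map_sum] at h3
  simpa only [map_smul, word_cons] using h3

lemma IsMinimal.exists_finset_ne_zero (h : G.IsMinimal)
    (hc : ∀ i, k + 1 ≤ i → ∀ b : G.B i, i + c ≤ ∑ l, G.deg i b l)
    (hβ : ∑ l, G.deg p β l = p + c) (hkp : k + 1 ≤ p) :
    ∃ U : Finset (Fin n), U.card = p - (k + 1) ∧ G.d k (const K (G.word U.toList
      (Pi.single p (Finsupp.single β 1)) (k + 1))) ≠ 0 := by
  obtain ⟨w, hw, hne⟩ := h.exists_word_ne_zero hc hβ (p - (k + 1)) (by omega)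
  rw [show p - (p - (k + 1)) = k + 1 by omega] at hne
  have hnd := h.nodup_of_word_ne_zero hne
  refine ⟨w.toFinset, by rw [List.toFinset_card_of_nodup hnd, hw], ?_⟩
  exact h.d_const_ne_zero (h.word_ne_zero_of_perm (List.toFinset_toList hnd).symm hne)

/-- Here k + 1 is the strand index of the theorem, so q = p - (k + 1) and the counting bound binom(q
+ k + 1, p - i) equals binom(p, i). -/
lemma IsMinimal.exists_faces (h : G.IsMinimal)
    (hc : ∀ i, k + 1 ≤ i → ∀ b : G.B i, i + c ≤ ∑ l, G.deg i b l)
    (hβ : ∑ l, G.deg p β l = p + c) (hkp : k + 1 ≤ p) {i : ℕ} (hki : k + 1 ≤ i) (hip : i ≤ p) :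
    ∃ F : Finset (Finset (Fin n)), p.choose i ≤ F.card ∧ ∀ A ∈ F, A.card = p - i ∧ ∃ U, A ⊆ U ∧
      G.word U.toList (Pi.single p (Finsupp.single β 1)) (k + 1) ≠ 0 := by
  obtain ⟨F, hF, hmem⟩ := exists_faces_of_cycle (fun j : Fin n => (X j : S))
    {m : G.B k →₀ S | ∃ y : G.B (k + 1) →₀ K, G.d k (const K y) = m} ⟨0, by simp only [map_zero]⟩
    (k + 1) (by
      rintro W v g hW hv _ ⟨y, rfl⟩ hg
      exact h.eq_zero_of_X_smul_eq_sum (by omega) hv y g hg) (p - (k + 1))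
    (fun H => G.d k (const K (G.word H.toList (Pi.single p (Finsupp.single β 1)) (k + 1))))
    (fun H => ⟨_, rfl⟩) (fun H _ => h.exists_sum_smul_eq_zero (hc _ le_rfl) hβ H)
    (h.exists_finset_ne_zero hc hβ hkp) (j := p - i) (by omega)
  rw [Nat.sub_add_cancel hkp, Nat.choose_symm hip] at hF
  refine ⟨F, hF, fun A hA => ?_⟩
  obtain ⟨hA, U, hAU, hzU⟩ := hmem A hA
  exact ⟨hA, U, hAU, fun h0 => hzU (by rw [h0, map_zero, map_zero])⟩

/-- The degrees occurring in the lowest strand of a minimal resolution. -/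
theorem IsMinimal.exists_degrees (h : G.IsMinimal) (hk : 1 ≤ k)
    (hc : ∀ i, k ≤ i → ∀ b : G.B i, i + c ≤ ∑ l, G.deg i b l)
    (hβ : ∑ l, G.deg p β l = p + c) (hkp : k ≤ p) {i : ℕ} (hki : k ≤ i) (hip : i ≤ p) :
    ∃ s : Finset (Fin n → ℤ), p.choose i ≤ s.card ∧
      ∀ a ∈ s, ∑ l, a l = i + c ∧ ∃ b : G.B i, G.deg i b = a := by
  obtain ⟨k, rfl⟩ := Nat.exists_eq_add_of_le' hk
  obtain ⟨F, hF, hmem⟩ := h.exists_faces hc hβ hkp hki hip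
  -- Distinct sets translate deg β by distinct 0/1 vectors.
  have hinj : Function.Injective fun A : Finset (Fin n) =>
      G.deg p β - (A.toList.map fun j => (Pi.single j 1 : Fin n → ℤ)).sum := by
    intro A A' hA
    have h1 := sub_right_injective hA
    simp only [sum_toList_single] at h1
    ext l
    have h2 := congrFun h1 l
    by_cases h3 : l ∈ A <;> by_cases h4 : l ∈ A' <;> simp_all
  refine ⟨F.map ⟨_, hinj⟩, by rwa [Finset.card_map], fun a ha => ?_⟩
  obtain ⟨A, hAF, rfl⟩ := Finset.mem_map.1 ha
  obtain ⟨hA, U, hAU, h1⟩ := hmem A hAF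
  -- Up to sign D_U = D_{U \ A} D_A, so D_A e_β ≠ 0; a nonzero coordinate of it is the required
  -- generator.
  have h2 := h.word_ne_zero_of_perm (toList_perm_append hAU) h1
  rw [word_append] at h2
  have h3 : G.word A.toList (Pi.single p (Finsupp.single β 1)) ≠ 0 := fun h0 => h2 (by rw [h0, map_zero]; rfl)
  obtain ⟨i', hi'⟩ := Function.ne_iff.1 h3
  obtain ⟨b, hb⟩ := Finsupp.ne_iff.1 hi'
  obtain ⟨h4, h5⟩ := G.eq_of_word_ne_zero β _ hb
  obtain rfl : i' = i := by rw [Finset.length_toList, hA] at h4; omega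
  have h6 : G.deg p β - (A.toList.map fun j => (Pi.single j 1 : Fin n → ℤ)).sum =
      G.deg i' b := by rw [← h5, add_sub_cancel_right]
  rw [Function.Embedding.coeFn_mk, h6]
  exact ⟨sum_deg_of_word_ne_zero hβ hb, b, rfl⟩

end LowestStrand

end FreeResolution

/-! ### Homogeneous lifting through graded free modules. -/

section Lifting

variable {K : Type u} [Field K] {n : ℕ}

local notation "S" => MvPolynomial (Fin n) K

/-- The degree a component of any preimage works, since the images of the other components must
vanish by independence of degrees. -/
lemma exists_homogeneous_preimage {B : Type*} (δ : B → Fin n → ℤ) {N : Type*} [AddCommGroup N]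
    [Module S N] (P : (Fin n → ℤ) → AddSubgroup N) (hP : SumFree fun a => (P a : Set N))
    (g : (B →₀ S) →ₗ[S] N) (hg : ∀ a, ∀ x ∈ freePiece K δ a, g x ∈ P a) {a : Fin n → ℤ}
    {u : B →₀ S} (hu : g u ∈ P a) : ∃ u' ∈ freePiece K δ a, g u' = g u := by
  classical
  have hx' : u ∈ ⨆ a, freePiece K δ a := by rw [iSup_freePiece]; trivial
  obtain ⟨f, hf, hfu⟩ := (Submodule.mem_iSup_iff_exists_finsupp _ _).1 hx'
  refine ⟨f a, hf a, ?_⟩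
  have h := hP (insert a f.support) (fun c => g (f c) - if c = a then g u else 0)
    (fun c _ => by
      refine (P c).sub_mem (hg c _ (hf c)) ?_
      split_ifs with hca
      · exact hca ▸ hu
      · exact (P c).zero_mem)
    (by
      rw [Finset.sum_sub_distrib, Finset.sum_ite_eq', if_pos (Finset.mem_insert_self _ _),
        ← map_sum, sub_eq_zero]
      rw [← hfu, Finsupp.sum]
      congr 1
      refine (Finset.sum_subset (Finset.subset_insert _ _) fun c _ hc => ?_).symm
      simpa using hc)
    a (Finset.mem_insert_self _ _)
  simpa [sub_eq_zero] using h

lemma linearCombination_mem {B B' : Type*} {δ : B → Fin n → ℤ} {δ' : B' → Fin n → ℤ}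
    {f : B → B' →₀ S} (hf : ∀ b, f b ∈ freePiece K δ' (δ b)) {a : Fin n → ℤ} {x : B →₀ S}
    (hx : x ∈ freePiece K δ a) : Finsupp.linearCombination S f x ∈ freePiece K δ' a := by
  rw [Finsupp.linearCombination_apply]
  refine Submodule.sum_mem _ fun b _ c => ?_
  have := mul_mem_polyPiece (hx b) (hf b c)
  simpa using this

/-- Graded free modules are graded projective. -/
lemma exists_graded_lift {B B' : Type*} (δ : B → Fin n → ℤ) (δ' : B' → Fin n → ℤ) {N : Type*}
    [AddCommGroup N] [Module S N] (P : (Fin n → ℤ) → AddSubgroup N)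
    (hP : SumFree fun a => (P a : Set N)) (g : (B' →₀ S) →ₗ[S] N)
    (hg : ∀ a, ∀ x ∈ freePiece K δ' a, g x ∈ P a) (f : (B →₀ S) →ₗ[S] N)
    (hf : ∀ a, ∀ x ∈ freePiece K δ a, f x ∈ P a) (hfg : ∀ x, ∃ y, g y = f x) :
    ∃ h : (B →₀ S) →ₗ[S] (B' →₀ S), (∀ a, ∀ x ∈ freePiece K δ a, h x ∈ freePiece K δ' a) ∧
      ∀ x, g (h x) = f x := by
  have h1 : ∀ b, ∃ y ∈ freePiece K δ' (δ b), g y = f (Finsupp.single b 1) := by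
    intro b
    obtain ⟨y, hy⟩ := hfg (Finsupp.single b 1)
    rw [← hy]
    refine exists_homogeneous_preimage δ' P hP g hg ?_
    rw [hy]
    exact hf _ _ (FreeResolution.single_mem_freePiece δ b)
  choose y hy hgy using h1
  refine ⟨Finsupp.linearCombination S y, fun a x hx => linearCombination_mem hy hx, ?_⟩
  intro x
  rw [← LinearMap.comp_apply]
  congr 1
  refine Finsupp.lhom_ext' fun b => LinearMap.ext_ring ?_
  simp [hgy]

lemma coef_zero_map_eq_zero {B B' : Type*} (d : (B →₀ S) →ₗ[S] (B' →₀ S)) {f : B →₀ S}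
    (hf : coef 0 f = 0) : coef 0 (d f) = 0 := by
  rw [coef_map]
  simp [hf]

lemma exists_deg_eq_of_coef_zero_ne_zero {B : Type*} {δ : B → Fin n → ℤ} {a : Fin n → ℤ}
    {x : B →₀ S} (hx : x ∈ freePiece K δ a) (h : coef 0 x ≠ 0) : ∃ b, δ b = a := by
  obtain ⟨b, hb⟩ := Finsupp.ne_iff.1 h
  refine ⟨b, ?_⟩
  have := eq_of_coeff_ne_zero (hx b) hb
  rw [eq_comm, sub_eq_iff_eq_add] at this
  rw [this]
  ext i
  simp

end Lifting

/-! ### Comparison of resolutions and nonvanishing of Tor. -/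

namespace FreeResolution

variable {K : Type u} [Field K] {n : ℕ} {M : Type v} [AddCommGroup M]
  [Module (MvPolynomial (Fin n) K) M] {ℳ : (Fin n → ℤ) → AddSubgroup M}

local notation "S" => MvPolynomial (Fin n) K

variable (F G : FreeResolution K n ℳ)

/-- A graded chain map over the identity of `M`. -/
structure Hom where
  map : ∀ i, (F.B i →₀ S) →ₗ[S] (G.B i →₀ S)
  map_mem : ∀ i a, ∀ x ∈ freePiece K (F.deg i) a, map i x ∈ freePiece K (G.deg i) a
  aug_map : ∀ x, G.aug (map 0 x) = F.aug x
  d_map : ∀ i x, G.d i (map (i + 1) x) = map i (F.d i x)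

/-- The invariant for the construction of chain maps step by step. -/
def IsLiftable (i : ℕ) (f : (F.B i →₀ S) →ₗ[S] (G.B i →₀ S)) : Prop :=
  (∀ a, ∀ x ∈ freePiece K (F.deg i) a, f x ∈ freePiece K (G.deg i) a) ∧
    ∀ x, ∃ y, G.d i y = f (F.d i x)

lemma exists_hom [DirectSum.Decomposition ℳ] : Nonempty (Hom F G) := by
  obtain ⟨f₀, hf₀, haug⟩ := exists_graded_lift (F.deg 0) (G.deg 0) ℳ
    (sumFree_of_decomposition ℳ) G.aug G.aug_mem F.aug F.aug_mem (fun x => G.aug_surjective _)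
  have hstep : ∀ i (f : {f // IsLiftable F G i f}), ∃ f' : {f // IsLiftable F G (i + 1) f},
      ∀ x, G.d i (f'.1 x) = f.1 (F.d i x) := by
    rintro i ⟨f, hf, hfd⟩
    obtain ⟨f', hf', hd⟩ := exists_graded_lift (F.deg (i + 1)) (G.deg (i + 1))
      (fun a => (freePiece K (G.deg i) a).toAddSubgroup) (sumFree_freePiece (G.deg i)) (G.d i)
      (G.d_mem i) (f ∘ₗ F.d i) (fun a x hx => hf a _ (F.d_mem i a x hx)) hfd
    refine ⟨⟨f', hf', fun x => (G.exact_succ i _).1 ?_⟩, hd⟩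
    rw [hd, LinearMap.comp_apply, F.d_d, map_zero]
  choose next hnext using hstep
  let φ : ∀ i, {f // IsLiftable F G i f} := fun i => Nat.rec
    ⟨f₀, hf₀, fun x => (G.exact_zero _).1 (by rw [haug]; exact (F.exact_zero _).2 ⟨x, rfl⟩)⟩
    (fun i f => next i f) i
  exact ⟨⟨fun i => (φ i).1, fun i => (φ i).2.1, haug, fun i => hnext i (φ i)⟩⟩

variable {F G} in
/-- A chain map over zero is null-homotopic. -/
lemma exists_homotopy (g : ∀ i, (F.B i →₀ S) →ₗ[S] (G.B i →₀ S))
    (hg : ∀ i a, ∀ x ∈ freePiece K (F.deg i) a, g i x ∈ freePiece K (G.deg i) a)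
    (haug : ∀ x, G.aug (g 0 x) = 0) (hd : ∀ i x, G.d i (g (i + 1) x) = g i (F.d i x)) (i : ℕ) :
    ∃ (h : (F.B i →₀ S) →ₗ[S] (G.B (i + 1) →₀ S))
      (h' : (F.B (i + 1) →₀ S) →ₗ[S] (G.B (i + 1 + 1) →₀ S)),
      (∀ a, ∀ x ∈ freePiece K (F.deg (i + 1)) a, h' x ∈ freePiece K (G.deg (i + 1 + 1)) a) ∧
      ∀ x, g (i + 1) x = G.d (i + 1) (h' x) + h (F.d i x) := by
  have hstep : ∀ i (h : (F.B i →₀ S) →ₗ[S] (G.B (i + 1) →₀ S)),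
      (∀ a, ∀ x ∈ freePiece K (F.deg i) a, h x ∈ freePiece K (G.deg (i + 1)) a) →
      (∀ x, G.d i (h (F.d i x)) = g i (F.d i x)) →
      ∃ h' : (F.B (i + 1) →₀ S) →ₗ[S] (G.B (i + 1 + 1) →₀ S),
      (∀ a, ∀ x ∈ freePiece K (F.deg (i + 1)) a, h' x ∈ freePiece K (G.deg (i + 1 + 1)) a) ∧
      ∀ x, G.d (i + 1) (h' x) = (g (i + 1) - h ∘ₗ F.d i) x := by
    intro i h hh hhd
    refine exists_graded_lift (F.deg (i + 1)) (G.deg (i + 1 + 1))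
      (fun a => (freePiece K (G.deg (i + 1)) a).toAddSubgroup)
      (sumFree_freePiece (G.deg (i + 1))) (G.d (i + 1)) (G.d_mem (i + 1)) (g (i + 1) - h ∘ₗ F.d i)
      (fun a x hx => Submodule.sub_mem _ (hg _ a x hx) (hh a _ (F.d_mem i a x hx)))
      (fun x => (G.exact_succ i _).1 ?_)
    rw [LinearMap.sub_apply, map_sub, hd, LinearMap.comp_apply, hhd, sub_self]
  -- The only trace of the earlier homotopies needed for the next lift is that ∂h agrees with g on
  -- boundaries; the induction carries just this.
  have hex : ∃ h : (F.B i →₀ S) →ₗ[S] (G.B (i + 1) →₀ S),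
      (∀ a, ∀ x ∈ freePiece K (F.deg i) a, h x ∈ freePiece K (G.deg (i + 1)) a) ∧
      (∀ x, G.d i (h (F.d i x)) = g i (F.d i x)) := by
    induction i with
    | zero =>
      obtain ⟨h, hh, hhd⟩ := exists_graded_lift (F.deg 0) (G.deg 1)
        (fun a => (freePiece K (G.deg 0) a).toAddSubgroup) (sumFree_freePiece (G.deg 0)) (G.d 0)
        (G.d_mem 0) (g 0) (hg 0) (fun x => (G.exact_zero _).1 (haug x))
      exact ⟨h, hh, fun x => hhd _⟩
    | succ i ih =>
      obtain ⟨h, hh, hhd⟩ := ih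
      obtain ⟨h', hh', hhd'⟩ := hstep i h hh hhd
      refine ⟨h', hh', fun x => ?_⟩
      rw [hhd', LinearMap.sub_apply, LinearMap.comp_apply, F.d_d, map_zero, sub_zero]
  obtain ⟨h, hh, hhd⟩ := hex
  obtain ⟨h', hh', hhd'⟩ := hstep i h hh hhd
  exact ⟨h, h', hh', fun x => by rw [hhd', LinearMap.sub_apply, LinearMap.comp_apply,
    sub_add_cancel]⟩

variable {F G} in
lemma Hom.exists_homotopy (φ : Hom F G) (ψ : Hom G F) (i : ℕ) :
    ∃ (h : (F.B i →₀ S) →ₗ[S] (F.B (i + 1) →₀ S))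
      (h' : (F.B (i + 1) →₀ S) →ₗ[S] (F.B (i + 1 + 1) →₀ S)),
      (∀ a, ∀ x ∈ freePiece K (F.deg (i + 1)) a, h' x ∈ freePiece K (F.deg (i + 1 + 1)) a) ∧
      ∀ x, ψ.map (i + 1) (φ.map (i + 1) x) - x = F.d (i + 1) (h' x) + h (F.d i x) :=
  FreeResolution.exists_homotopy (fun i => ψ.map i ∘ₗ φ.map i - LinearMap.id)
    (fun i a x hx => Submodule.sub_mem _ (ψ.map_mem _ _ _ (φ.map_mem _ _ _ hx)) hx)
    (fun x => by
      rw [LinearMap.sub_apply, map_sub, LinearMap.comp_apply, ψ.aug_map, φ.aug_map]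
      exact sub_self _)
    (fun i x => by
      simp only [LinearMap.sub_apply, map_sub, LinearMap.comp_apply, ψ.d_map, φ.d_map,
        LinearMap.id_apply]) i

section Reduced

lemma coef_zero_eq_zero_iff {B : Type*} (f : B →₀ S) :
    coef 0 f = 0 ↔ f ∈ Ideal.span (Set.range (X : Fin n → S)) • (⊤ : Submodule S (B →₀ S)) := by
  rw [mem_ideal_smul_top_iff, Finsupp.ext_iff]
  refine forall_congr' fun b => ?_
  rw [← Set.image_univ, mem_ideal_span_X_image]
  constructor
  · intro h m hm
    by_contra! h0
    obtain rfl : m = 0 := Finsupp.ext fun i => h0 i trivial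
    exact mem_support_iff.1 hm h
  · intro h
    by_contra h0
    obtain ⟨i, -, hi⟩ := h 0 (mem_support_iff.2 h0)
    exact hi rfl

/-- Since K ⊗ F_i = F_i / (X_1, …, X_n) F_i, computations in the reduced complex become computations
with constant terms. -/
lemma toReduced_eq_zero_iff (i : ℕ) (x : F.B i →₀ S) : F.toReduced i x = 0 ↔ coef 0 x = 0 := by
  rw [coef_zero_eq_zero_iff, ← Submodule.Quotient.mk_eq_zero]
  have : TensorProduct.quotTensorEquivQuotSMul (F.B i →₀ S)
      (Ideal.span (Set.range (X : Fin n → S))) (F.toReduced i x) = Submodule.Quotient.mk x :=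
    TensorProduct.quotTensorEquivQuotSMul_mk_one_tmul _ _
  rw [← this]
  exact (LinearEquiv.map_eq_zero_iff _).symm

lemma reducedD_toReduced (i : ℕ) (x : F.B (i + 1) →₀ S) :
    F.reducedD i (F.toReduced (i + 1) x) = F.toReduced i (F.d i x) := rfl

lemma nontrivial_homology_iff (i : ℕ) (a : Fin n → ℤ) : Nontrivial (F.homology (i + 1) a) ↔
    ∃ x ∈ freePiece K (F.deg (i + 1)) a, coef 0 (F.d i x) = 0 ∧
      ∀ u ∈ freePiece K (F.deg (i + 1 + 1)) a, coef 0 (x - F.d (i + 1) u) ≠ 0 := by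
  rw [Submodule.Quotient.nontrivial_iff, Ne, Submodule.submoduleOf_eq_top, SetLike.not_le_iff_exists]
  constructor
  · rintro ⟨_, ⟨⟨x, hx, rfl⟩, hker⟩, hnot⟩
    refine ⟨x, hx, ?_, fun u hu h0 => hnot ?_⟩
    · rwa [SetLike.mem_coe, LinearMap.mem_ker, reducedD_toReduced, toReduced_eq_zero_iff] at hker
    · refine ⟨_, ⟨u, hu, rfl⟩, ?_⟩
      rw [← toReduced_eq_zero_iff, map_sub, sub_eq_zero] at h0
      rw [h0, reducedD_toReduced]
  · rintro ⟨x, hx, hd, hnot⟩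
    refine ⟨F.toReduced (i + 1) x, ⟨⟨x, hx, rfl⟩, ?_⟩, ?_⟩
    · rwa [SetLike.mem_coe, LinearMap.mem_ker, reducedD_toReduced, toReduced_eq_zero_iff]
    · rintro ⟨_, ⟨u, hu, rfl⟩, h⟩
      refine hnot u hu ?_
      rw [← toReduced_eq_zero_iff, map_sub, sub_eq_zero, ← h, reducedD_toReduced]

end Reduced

variable {G} in
/-- `Tor_i(M, K)_a` vanishes if and only if a minimal resolution has no generator of degree `a` in
homological degree `i`. -/
theorem IsMinimal.nontrivial_homology_iff [DirectSum.Decomposition ℳ] (hG : G.IsMinimal) (i : ℕ)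
    (a : Fin n → ℤ) :
    Nontrivial (F.homology (i + 1) a) ↔ ∃ b : G.B (i + 1), G.deg (i + 1) b = a := by
  obtain ⟨φ⟩ := exists_hom F G
  obtain ⟨ψ⟩ := exists_hom G F
  rw [FreeResolution.nontrivial_homology_iff]
  constructor
  -- Without a generator of degree a, φ x has no constant terms; the homotopy from ψφ to the
  -- identity then makes x a boundary modulo the variables.
  · rintro ⟨x, hx, hd, hnot⟩
    by_contra hcon
    obtain ⟨h, h', hh', hx'⟩ := φ.exists_homotopy ψ i
    apply hnot (-h' x) (Submodule.neg_mem _ (hh' a x hx))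
    have h1 : coef 0 (φ.map (i + 1) x) = 0 := by
      by_contra h0
      exact hcon (exists_deg_eq_of_coef_zero_ne_zero (φ.map_mem _ _ _ hx) h0)
    have h2 : x - F.d (i + 1) (-h' x) = ψ.map (i + 1) (φ.map (i + 1) x) - h (F.d i x) := by
      rw [map_neg, sub_neg_eq_add, eq_sub_iff_add_eq, add_assoc, ← hx', add_sub_cancel]
    rw [h2, map_sub, coef_zero_map_eq_zero _ h1, coef_zero_map_eq_zero _ hd, sub_zero]
  -- The class of ψ e_b is nonzero: were it a boundary, φψ e_b would have no constant terms, whereas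
  -- over the minimal `G` the homotopy shows φψ e_b and e_b to have the same constant terms.
  · rintro ⟨b, rfl⟩
    obtain ⟨h, h', hh', hx'⟩ := ψ.exists_homotopy φ i
    refine ⟨ψ.map (i + 1) (Finsupp.single b 1), ψ.map_mem _ _ _ (single_mem_freePiece _ b), ?_, ?_⟩
    · rw [ψ.d_map]
      exact coef_zero_map_eq_zero _ (hG _ _)
    · intro u hu h0
      have h1 := hx' (Finsupp.single b 1)
      have h2 := coef_zero_map_eq_zero (φ.map (i + 1)) h0
      rw [map_sub, ← φ.d_map, map_sub, hG, sub_zero] at h2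
      have h3 := congrArg (coef 0) h1
      rw [map_sub, h2, map_add, hG, coef_zero_map_eq_zero _ (hG _ _), zero_sub, add_zero,
        neg_eq_zero] at h3
      have h4 := DFunLike.congr_fun h3 b
      simp at h4

end FreeResolution

/-! ### Graded Nakayama and the construction of minimal resolutions. -/

section Minimal

variable {K : Type u} [Field K] {n : ℕ}

local notation "S" => MvPolynomial (Fin n) K

/-- The maps `π a` are the projections onto the pieces `P a` of a grading. -/
structure IsGrading (K : Type u) [Field K] {n : ℕ} {Q : Type w} [AddCommGroup Q]
    [Module (MvPolynomial (Fin n) K) Q] (P : (Fin n → ℤ) → AddSubgroup Q)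
    (π : (Fin n → ℤ) → Q →+ Q) : Prop where
  smul_mem : ∀ {a b} {p : MvPolynomial (Fin n) K} {x : Q}, p ∈ polyPiece K n a → x ∈ P b →
    p • x ∈ P (a + b)
  same : ∀ {a x}, x ∈ P a → π a x = x
  ne : ∀ {a b x}, x ∈ P b → b ≠ a → π a x = 0

lemma span_induction_homogeneous {Q : Type w} [AddCommGroup Q] [Module S Q] {A : Set Q}
    {motive : Q → Prop} (zero : motive 0) (add : ∀ x y, motive x → motive y → motive (x + y))
    (smul : ∀ a, ∀ p ∈ polyPiece K n a, ∀ x ∈ A, motive (p • x)) {y : Q}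
    (hy : y ∈ Submodule.span S A) : motive y := by
  obtain ⟨r, f, g, rfl⟩ := Submodule.mem_span_set'.1 hy
  refine Finset.sum_induction _ motive add zero fun i _ => ?_
  have hp : f i ∈ ⨆ a, polyPiece K n a := by rw [iSup_polyPiece]; trivial
  generalize f i = p at hp
  induction hp using Submodule.iSup_induction' with
  | mem a p hp => exact smul a p hp _ (g i).2
  | zero => rwa [zero_smul]
  | add p q _ _ hp hq => rw [add_smul]; exact add _ _ hp hq

lemma sum_nonneg_of_ne_zero {a : Fin n → ℤ} {p : S} (hp : p ∈ polyPiece K n a) (h : p ≠ 0) :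
    0 ≤ ∑ l, a l := by
  obtain ⟨m, hm⟩ := ne_zero_iff.1 h
  rw [← eq_of_coeff_ne_zero hp hm]
  exact Finset.sum_nonneg fun l _ => by positivity

section IsGrading

variable {Q : Type w} [AddCommGroup Q] [Module (MvPolynomial (Fin n) K) Q] {P : (Fin n → ℤ) → AddSubgroup Q}
  {π : (Fin n → ℤ) → Q →+ Q}

lemma IsGrading.proj_mem_span (hQ : IsGrading K P π) {A : Set Q} (hA : ∀ x ∈ A, ∃ b, x ∈ P b)
    (a : Fin n → ℤ) {y : Q} (hy : y ∈ Submodule.span S A) : π a y ∈ Submodule.span S A := by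
  refine span_induction_homogeneous (motive := fun y => π a y ∈ Submodule.span S A)
    (by simp) (fun x y hx hy => by rw [map_add]; exact Submodule.add_mem _ hx hy) ?_ hy
  intro e p hp x hx
  obtain ⟨b, hb⟩ := hA x hx
  by_cases h : e + b = a
  · subst h
    rw [hQ.same (hQ.smul_mem hp hb)]
    exact Submodule.smul_mem _ _ (Submodule.subset_span hx)
  · rw [hQ.ne (hQ.smul_mem hp hb) h]
    exact Submodule.zero_mem _

lemma IsGrading.proj_eq_zero (hQ : IsGrading K P π) {A : Set Q} {t : ℤ}
    (hA : ∀ x ∈ A, ∃ b, x ∈ P b ∧ t ≤ ∑ l, b l) {a : Fin n → ℤ} (ha : ∑ l, a l < t) {y : Q}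
    (hy : y ∈ Submodule.span S A) : π a y = 0 := by
  refine span_induction_homogeneous (motive := fun y => π a y = 0)
    (by simp) (fun x y hx hy => by rw [map_add, hx, hy, add_zero]) ?_ hy
  intro e p hp x hx
  obtain ⟨b, hb, hbt⟩ := hA x hx
  by_cases hp0 : p = 0
  · rw [hp0, zero_smul, map_zero]
  refine hQ.ne (hQ.smul_mem hp hb) fun h => ?_
  have := sum_nonneg_of_ne_zero hp hp0
  rw [← h] at ha
  simp only [Pi.add_apply, Finset.sum_add_distrib] at ha
  omega

/-- Nakayama's lemma for graded modules bounded below. -/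
lemma IsGrading.le_of_le_sup_smul (hQ : IsGrading K P π) {R R' : Submodule S Q} {A : Set Q}
    (hR' : R' = Submodule.span S A) (hA : ∀ x ∈ A, ∃ b, x ∈ P b)
    (hR : R ≤ Submodule.span S {x | x ∈ R ∧ ∃ a, x ∈ P a}) {c : ℤ}
    (hc : ∀ a, ∑ l, a l < c → ∀ x ∈ R, x ∈ P a → x = 0)
    (h : R ≤ R' ⊔ Ideal.span (Set.range (X : Fin n → S)) • R) : R ≤ R' := by
  -- Each use of `h` multiplies the remainder by a variable and so raises its total degree. For a
  -- homogeneous x, choosing s beyond its total degree kills the remainder under projection.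
  have hs : ∀ s : ℕ, R ≤ R' ⊔ Submodule.span S {x | x ∈ R ∧ ∃ a, x ∈ P a ∧ c + s ≤ ∑ l, a l} := by
    intro s
    induction s with
    | zero =>
      refine le_sup_of_le_right (hR.trans (Submodule.span_le.2 ?_))
      rintro x ⟨hx, a, ha⟩
      by_cases hac : ∑ l, a l < c
      · rw [hc a hac x hx ha]; exact Submodule.zero_mem _
      · exact Submodule.subset_span ⟨hx, a, ha, by push_cast; omega⟩
    | succ s ih =>
      refine h.trans (sup_le le_sup_left ?_)
      refine (Submodule.smul_mono le_rfl ih).trans ?_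
      rw [Submodule.smul_sup]
      refine sup_le_sup Submodule.smul_le_right ?_
      rw [Submodule.span_smul_span, Submodule.span_le]
      rintro _ ⟨_, ⟨j, rfl⟩, x, ⟨hx, a, ha, hac⟩, rfl⟩
      refine Submodule.subset_span ⟨Submodule.smul_mem _ _ hx, _,
        hQ.smul_mem (X_mem_polyPiece j) ha, ?_⟩
      simp only [Pi.add_apply, Finset.sum_add_distrib, Finset.sum_pi_single']
      simp
      omega
  refine hR.trans (Submodule.span_le.2 ?_)
  rintro x ⟨hx, a, ha⟩
  obtain ⟨s, hsa⟩ : ∃ s : ℕ, ∑ l, a l < c + s := ⟨(∑ l, a l - c + 1).toNat, by omega⟩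
  obtain ⟨r, hr, y, hy, rfl⟩ := Submodule.mem_sup.1 (hs s hx)
  rw [SetLike.mem_coe, ← hQ.same ha, map_add,
    hQ.proj_eq_zero (fun x hx => hx.2) hsa hy, add_zero, hR']
  exact hQ.proj_mem_span hA a (hR' ▸ hr)

/-- Minimal homogeneous generators. -/
theorem IsGrading.exists_minimal_generators (hQ : IsGrading K P π) {R : Submodule S Q}
    (hR : R ≤ Submodule.span S {x | x ∈ R ∧ ∃ a, x ∈ P a}) {c : ℤ}
    (hc : ∀ a, ∑ l, a l < c → ∀ x ∈ R, x ∈ P a → x = 0) :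
    ∃ (B : Type (max u w)) (deg : B → Fin n → ℤ) (x : B → Q), (∀ b, x b ∈ P (deg b)) ∧
      (∀ b, c ≤ ∑ l, deg b l) ∧ Submodule.span S (Set.range x) = R ∧
      ∀ f : B →₀ S, Finsupp.linearCombination S x f = 0 → coef 0 f = 0 := by
  let I := Ideal.span (Set.range (X : Fin n → S))
  let V := Q ⧸ (I • R)
  let : Module K V := Module.compHom V (C : K →+* S)
  let ι := ULift.{u} {γ : (Fin n → ℤ) × Q // γ.2 ∈ R ∧ γ.2 ∈ P γ.1}
  let x : ι → Q := fun γ => γ.down.1.2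
  let mk := (I • R).mkQ
  have hmk : ∀ (p : S) (y : Q), y ∈ R → mk (p • y) = coeff 0 p • mk y := by
    intro p y hy
    change mk (p • y) = (C (coeff 0 p) : S) • mk y
    rw [← map_smul, ← sub_eq_zero, ← map_sub, ← sub_smul]
    refine (Submodule.Quotient.mk_eq_zero _).2 (Submodule.smul_mem_smul ?_ hy)
    change _ ∈ Ideal.span (Set.range X)
    rw [← Set.image_univ, mem_ideal_span_X_image]
    intro m hm
    by_contra! h0
    obtain rfl : m = 0 := Finsupp.ext fun i => h0 i trivial
    simp [mem_support_iff] at hm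
  -- A K-basis of the image of R modulo the variables, taken among classes of homogeneous elements:
  -- spanning yields generation by Nakayama, independence yields minimality.
  obtain ⟨B, a, -, hspan, hli⟩ := exists_linearIndependent' K (fun γ => mk (x γ))
  have hxR : ∀ b, x (a b) ∈ R := fun b => (a b).down.2.1
  refine ⟨B, fun b => (a b).down.1.1, fun b => x (a b), fun b => (a b).down.2.2, ?_, ?_, ?_⟩
  · intro b
    by_contra! hb
    refine hli.ne_zero b ?_
    have : x (a b) = 0 := hc _ hb _ (hxR b) (a b).down.2.2
    simp [this]
  · apply le_antisymm
    · rw [Submodule.span_le]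
      rintro _ ⟨b, rfl⟩
      exact hxR b
    · refine hQ.le_of_le_sup_smul rfl ?_ hR hc ?_
      · rintro _ ⟨b, rfl⟩
        exact ⟨_, (a b).down.2.2⟩
      · have h1 : ∀ z ∈ Submodule.span K (Set.range fun γ => mk (x γ)),
            ∃ r ∈ Submodule.span S (Set.range fun b => x (a b)), mk r = z := by
          intro z hz
          rw [← hspan] at hz
          induction hz using Submodule.span_induction with
          | mem z hz =>
            obtain ⟨b, rfl⟩ := hz
            exact ⟨_, Submodule.subset_span ⟨b, rfl⟩, rfl⟩
          | zero => exact ⟨0, Submodule.zero_mem _, map_zero _⟩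
          | add z z' _ _ h h' =>
            obtain ⟨r, hr, rfl⟩ := h
            obtain ⟨r', hr', rfl⟩ := h'
            exact ⟨_, Submodule.add_mem _ hr hr', map_add _ _ _⟩
          | smul k z _ h =>
            obtain ⟨r, hr, rfl⟩ := h
            exact ⟨_, Submodule.smul_mem _ (C k) hr, map_smul _ _ _⟩
        have h2 : ∀ r ∈ Submodule.span S {x | x ∈ R ∧ ∃ a, x ∈ P a},
            mk r ∈ Submodule.span K (Set.range fun γ => mk (x γ)) := by
          intro r hr
          refine span_induction_homogeneous
            (motive := fun r => mk r ∈ Submodule.span K (Set.range fun γ => mk (x γ))) (by simp)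
            (fun _ _ h h' => by rw [map_add]; exact Submodule.add_mem _ h h') ?_ hr
          rintro _ p - y ⟨hy, e, hye⟩
          rw [hmk p y hy]
          exact Submodule.smul_mem _ _ (Submodule.subset_span ⟨⟨⟨(e, y), hy, hye⟩⟩, rfl⟩)
        intro r hr
        obtain ⟨r', hr', h⟩ := h1 _ (h2 r (hR hr))
        rw [← sub_add_cancel r r', add_comm]
        refine Submodule.add_mem_sup hr' ?_
        rw [← Submodule.Quotient.mk_eq_zero, ← Submodule.mkQ_apply, map_sub, sub_eq_zero]
        exact h.symm
  · intro f hf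
    rw [linearIndependent_iff] at hli
    refine hli _ ?_
    rw [Finsupp.linearCombination_apply] at hf
    have h1 := congrArg mk hf
    rw [map_finsuppSum, map_zero] at h1
    rw [← h1, Finsupp.linearCombination_apply]
    refine (Finsupp.sum_of_support_subset _ (s := f.support) ?_ _ (by simp)).trans ?_
    · intro b hb
      rw [Finsupp.mem_support_iff, coef_apply] at hb
      rw [Finsupp.mem_support_iff]
      intro h0
      simp [h0] at hb
    · exact Finset.sum_congr rfl fun b _ => (hmk _ _ (hxR b)).symm

end IsGrading

/-- The projections of a graded free module onto its pieces. -/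
def freeProj {B : Type*} (δ : B → Fin n → ℤ) (a : Fin n → ℤ) : (B →₀ S) →ₗ[K] (B →₀ S) :=
  Finsupp.lsum K fun b => Finsupp.lsingle b ∘ₗ
    weightedHomogeneousComponent (fun i : Fin n => (Pi.single i 1 : Fin n → ℤ)) (a - δ b)

lemma isGrading_freePiece {B : Type*} (δ : B → Fin n → ℤ) :
    IsGrading K (fun a => (freePiece K δ a).toAddSubgroup)
      (fun a => (freeProj (K := K) δ a).toAddMonoidHom) where
  smul_mem {a b p x} hp hx c := by
    have := mul_mem_polyPiece hp (hx c)
    rwa [← add_sub_assoc] at this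
  same {a x} hx := by
    change freeProj δ a x = x
    rw [freeProj, Finsupp.lsum_apply]
    conv_rhs => rw [← Finsupp.sum_single x]
    refine Finsupp.sum_congr fun b _ => ?_
    simp [IsWeightedHomogeneous.weightedHomogeneousComponent_same (hx b)]
  ne {a b x} hx hab := by
    change freeProj δ a x = 0
    rw [freeProj, Finsupp.lsum_apply]
    refine Finset.sum_eq_zero fun c _ => ?_
    dsimp only
    rw [LinearMap.comp_apply, IsWeightedHomogeneous.weightedHomogeneousComponent_ne _ (hx c),
      map_zero]
    simpa [eq_comm] using hab

/-- A stage bounded below. -/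
abbrev BoundedStage (K : Type u) [Field K] (n : ℕ) (c : ℤ) : Type (max u v + 1) :=
  {s : Stage.{u, v} K n // ∀ a, ∑ l, a l < c → ∀ x ∈ s.rel, x ∈ freePiece K s.deg a → x = 0}

namespace BoundedStage

variable {c : ℤ} (s : BoundedStage.{u, v} K n c)

lemma exists_generators : ∃ (B : Type (max u v)) (deg : B → Fin n → ℤ) (x : B → s.1.B →₀ S),
    (∀ b, x b ∈ freePiece K s.1.deg (deg b)) ∧ (∀ b, c ≤ ∑ l, deg b l) ∧
      Submodule.span S (Set.range x) = s.1.rel ∧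
      ∀ f : B →₀ S, Finsupp.linearCombination S x f = 0 → coef 0 f = 0 :=
  (isGrading_freePiece s.1.deg).exists_minimal_generators s.1.rel_le s.2

/-- The minimal generators of the submodule. -/
def Gen : Type (max u v) := s.exists_generators.choose

/-- The degrees of the minimal generators. -/
def genDeg : s.Gen → Fin n → ℤ := s.exists_generators.choose_spec.choose

/-- The minimal generators as elements. -/
def genVec : s.Gen → s.1.B →₀ S := s.exists_generators.choose_spec.choose_spec.choose

/-- The map from the free module on the minimal generators. -/
def map : (s.Gen →₀ S) →ₗ[S] (s.1.B →₀ S) :=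
  Finsupp.linearCombination S s.genVec

lemma map_mem (a : Fin n → ℤ) (x : s.Gen →₀ S) (hx : x ∈ freePiece K s.genDeg a) :
    s.map x ∈ freePiece K s.1.deg a :=
  linearCombination_mem s.exists_generators.choose_spec.choose_spec.choose_spec.1 hx

lemma le_genDeg (b : s.Gen) : c ≤ ∑ l, s.genDeg b l :=
  s.exists_generators.choose_spec.choose_spec.choose_spec.2.1 b

lemma range_map : LinearMap.range s.map = s.1.rel := by
  rw [map, Finsupp.range_linearCombination]
  exact s.exists_generators.choose_spec.choose_spec.choose_spec.2.2.1

lemma coef_eq_zero {f : s.Gen →₀ S} (hf : s.map f = 0) : coef 0 f = 0 :=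
  s.exists_generators.choose_spec.choose_spec.choose_spec.2.2.2 f hf

lemma eq_zero_of_mem_freePiece {B : Type*} {δ : B → Fin n → ℤ} (hδ : ∀ b, c ≤ ∑ l, δ b l)
    {a : Fin n → ℤ} (ha : ∑ l, a l < c) {x : B →₀ S} (hx : x ∈ freePiece K δ a) : x = 0 := by
  ext1 b
  by_contra h
  have h1 := sum_nonneg_of_ne_zero (hx b) h
  simp only [Pi.sub_apply, Finset.sum_sub_distrib] at h1
  have := hδ b
  omega

/-- The next step: the free module on the minimal generators, with the kernel of the map. -/
def next : BoundedStage.{u, v} K n c :=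
  ⟨{ B := s.Gen
     deg := s.genDeg
     rel := LinearMap.ker s.map
     rel_le := ker_le_span _ _ (sumFree_freePiece s.1.deg) s.map s.map_mem },
    fun _ ha _ _ hx => eq_zero_of_mem_freePiece s.le_genDeg ha hx⟩

lemma exact : Function.Exact s.next.map s.map :=
  LinearMap.exact_iff.2 s.next.range_map.symm

end BoundedStage

variable {M : Type v} [AddCommGroup M] [Module (MvPolynomial (Fin n) K) M] (ℳ : (Fin n → ℤ) → AddSubgroup M)
  [DirectSum.Decomposition ℳ] [SetLike.GradedSMul (polyPiece K n) ℳ]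

/-- The projections onto the pieces of a decomposition. -/
def proj (a : Fin n → ℤ) : M →+ M :=
  AddMonoidHom.mk' (fun x => (DirectSum.decompose ℳ x a : M)) (by simp [DirectSum.decompose_add])

lemma isGrading_proj : IsGrading K ℳ (proj ℳ) where
  smul_mem hp hx := SetLike.GradedSMul.smul_mem hp hx
  same hx := DirectSum.decompose_of_mem_same ℳ hx
  ne hx h := DirectSum.decompose_of_mem_ne ℳ hx h

/-- A finite generating set has finitely many homogeneous components, and multiplication by
polynomials cannot lower total degree. -/
lemma exists_lower_bound [Module.Finite S M] :
    ∃ c : ℤ, ∀ a, ∑ l, a l < c → ∀ x ∈ ℳ a, x = 0 := by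
  classical
  obtain ⟨s, hs⟩ := (Module.Finite.fg_top : (⊤ : Submodule S M).FG)
  let T : Finset (Fin n → ℤ) := s.biUnion fun x => (DirectSum.decompose ℳ x).support
  obtain ⟨c, hc⟩ := (T.image fun a => ∑ l, a l).bddBelow
  refine ⟨c, fun a ha x hx => ?_⟩
  have hspan : Submodule.span S {y : M | ∃ b, y ∈ ℳ b ∧ c ≤ ∑ l, b l} = ⊤ := by
    rw [eq_top_iff, ← hs, Submodule.span_le]
    intro y hy
    rw [SetLike.mem_coe, ← DirectSum.sum_support_decompose ℳ y]
    refine Submodule.sum_mem _ fun b hb => Submodule.subset_span ⟨b, (DirectSum.decompose ℳ y b).2,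
      hc ?_⟩
    rw [Finset.mem_coe, Finset.mem_image]
    exact ⟨b, Finset.mem_biUnion.2 ⟨y, hy, hb⟩, rfl⟩
  have hQ := isGrading_proj (K := K) ℳ
  rw [← hQ.same hx]
  have hxs : x ∈ Submodule.span S {y : M | ∃ b, y ∈ ℳ b ∧ c ≤ ∑ l, b l} := by rw [hspan]; trivial
  exact hQ.proj_eq_zero (fun y hy => hy) ha hxs

/-- Graded modules bounded below have minimal graded free resolutions. -/
theorem exists_minimal_resolution {c : ℤ} (hc : ∀ a, ∑ l, a l < c → ∀ x ∈ ℳ a, x = 0) :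
    ∃ G : FreeResolution K n ℳ, G.IsMinimal ∧ ∀ i b, c ≤ ∑ l, G.deg i b l := by
  have hQ := isGrading_proj (K := K) ℳ
  obtain ⟨B, deg, x, hx, hdeg, hspan, hmin⟩ := hQ.exists_minimal_generators (R := ⊤)
    (by
      intro y _
      classical
      rw [← DirectSum.sum_support_decompose ℳ y]
      exact Submodule.sum_mem _ fun b hb => Submodule.subset_span
        ⟨trivial, b, (DirectSum.decompose ℳ y b).2⟩)
    (c := c) (fun a ha x _ hx => hc a ha x hx)
  let aug := Finsupp.linearCombination S x
  have haug : ∀ a, ∀ f ∈ freePiece K deg a, aug f ∈ ℳ a := by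
    intro a f hf
    change Finsupp.linearCombination S x f ∈ ℳ a
    rw [Finsupp.linearCombination_apply]
    refine AddSubgroup.sum_mem _ fun b _ => ?_
    have := hQ.smul_mem (hf b) (hx b)
    simpa using this
  let s₀ : BoundedStage.{u, v} K n c :=
    ⟨{ B := B
       deg := deg
       rel := LinearMap.ker aug
       rel_le := ker_le_span _ _ (sumFree_of_decomposition ℳ) aug haug },
      fun _ ha _ _ hx => BoundedStage.eq_zero_of_mem_freePiece hdeg ha hx⟩
  let st : ℕ → BoundedStage.{u, v} K n c := fun i => Nat.rec s₀ (fun _ s => s.next) i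
  have hbound : ∀ i b, c ≤ ∑ l, (st i).1.deg b l := by
    rintro (_ | i) b
    · exact hdeg b
    · exact (st i).le_genDeg b
  -- Each `rel` is the module of relations among minimal generators and is the image of the next
  -- differential, whence minimality.
  have hrel : ∀ i, ∀ f ∈ (st i).1.rel, coef 0 f = 0 := by
    rintro (_ | i) f hf
    · exact hmin f hf
    · exact (st i).coef_eq_zero hf
  have hex : Function.Exact s₀.map aug := LinearMap.exact_iff.2 s₀.range_map.symm
  let G : FreeResolution K n ℳ :=
    { B := fun i => (st i).1.B
      deg := fun i => (st i).1.deg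
      aug := aug
      d := fun i => (st i).map
      aug_mem := haug
      d_mem := fun i => (st i).map_mem
      aug_surjective := by
        rw [← LinearMap.range_eq_top, Finsupp.range_linearCombination, hspan]
      exact_zero := hex
      exact_succ := fun i => (st i).exact }
  refine ⟨G, fun i f => hrel i _ ?_, hbound⟩
  rw [← (st i).range_map]
  exact ⟨f, rfl⟩

end Minimal

/-! ### Betti numbers read off from a minimal resolution. -/

section BettiNumbers

variable {K : Type u} [Field K] {n : ℕ} {M : Type v} [AddCommGroup M]
  [Module (MvPolynomial (Fin n) K) M] {ℳ : (Fin n → ℤ) → AddSubgroup M}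
  [DirectSum.Decomposition ℳ] [SetLike.GradedSMul (polyPiece K n) ℳ]

lemma multiBetti_ne_zero_iff {G : FreeResolution K n ℳ} (hG : G.IsMinimal) {i : ℕ} (hi : 1 ≤ i)
    (a : Fin n → ℤ) : multiBetti K ℳ i a ≠ 0 ↔ ∃ b : G.B i, G.deg i b = a := by
  obtain ⟨i, rfl⟩ := Nat.exists_eq_add_of_le' hi
  rw [← hG.nontrivial_homology_iff (resolution K ℳ), multiBetti, ← pos_iff_ne_zero,
    rank_pos_iff_nontrivial]

lemma betti_ne_zero_iff {G : FreeResolution K n ℳ} (hG : G.IsMinimal) {i : ℕ} (hi : 1 ≤ i)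
    (j : ℤ) : betti K ℳ i j ≠ 0 ↔ ∃ b : G.B i, ∑ l, G.deg i b l = j := by
  rw [betti, Cardinal.sum, Cardinal.mk_ne_zero_iff]
  constructor
  · rintro ⟨⟨a, ha⟩, x⟩
    obtain ⟨b, hb⟩ := (multiBetti_ne_zero_iff hG hi a).1 (by
      rw [← Cardinal.mk_out (multiBetti K ℳ i a), Cardinal.mk_ne_zero_iff]; exact ⟨x⟩)
    exact ⟨b, by rw [hb, ha]⟩
  · rintro ⟨b, hb⟩
    have h := (multiBetti_ne_zero_iff hG hi _).2 ⟨b, rfl⟩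
    rw [← Cardinal.mk_out (multiBetti K ℳ i _), Cardinal.mk_ne_zero_iff] at h
    exact ⟨⟨⟨G.deg i b, hb⟩, h.some⟩⟩

lemma card_le_betti {i : ℕ} {j : ℤ} (s : Finset (Fin n → ℤ))
    (hs : ∀ a ∈ s, ∑ l, a l = j ∧ multiBetti K ℳ i a ≠ 0) : (s.card : Cardinal) ≤ betti K ℳ i j := by
  have h : ∀ a : s, Nonempty (multiBetti K ℳ i a).out := fun a => by
    rw [← Cardinal.mk_ne_zero_iff, Cardinal.mk_out]
    exact (hs a a.2).2
  have h2 : Cardinal.mk (ULift.{max u v} s) = (s.card : Cardinal) := by simp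
  rw [← h2, betti, Cardinal.sum]
  refine Cardinal.mk_le_of_injective
    (f := fun a => ⟨⟨a.down, (hs _ a.down.2).1⟩, (h a.down).some⟩) fun a a' haa' => ?_
  have h3 := congrArg (fun x => x.1.1) haa'
  exact ULift.ext _ _ (Subtype.ext h3)

/-- Above k the bound propagates: ∂e_b is nonzero without constant terms, so it involves a generator
of strictly smaller total degree one step below. -/
lemma add_dk_le_of_deg {G : FreeResolution K n ℳ} (hG : G.IsMinimal) {c : ℤ}
    (hc : ∀ i b, c ≤ ∑ l, G.deg i b l) {k : ℕ} (hk : 1 ≤ k) {i : ℕ} (hki : k ≤ i) (b : G.B i) :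
    i + dk K ℳ k ≤ ∑ l, G.deg i b l := by
  induction i, hki using Nat.le_induction with
  | base =>
    have h : dk K ℳ k ≤ ∑ l, G.deg k b l - k := by
      -- An integer `sInf` is meaningful only for sets bounded below, which is where the bound c on
      -- the degrees of `G` enters. The value of the regularity plays no role.
      refine csInf_le ?_ (Or.inl ((betti_ne_zero_iff hG hk _).2 ⟨b, by ring⟩))
      rw [bddBelow_union]
      refine ⟨⟨c - k, ?_⟩, bddBelow_singleton⟩
      intro j hj
      obtain ⟨b, hb⟩ := (betti_ne_zero_iff hG hk _).1 hj
      have := hc k b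
      omega
    omega
  | succ i hki ih =>
    have h1 := hG.d_const_ne_zero (v := Finsupp.single b (1 : K)) (by simp)
    obtain ⟨b', hb'⟩ := Finsupp.ne_iff.1 h1
    obtain ⟨m, hm⟩ := ne_zero_iff.1 hb'
    obtain ⟨β, hβ, h2⟩ := G.eq_of_coeff_d_ne_zero hm
    obtain rfl : β = b := by
      by_contra hne
      exact hβ (Finsupp.single_eq_of_ne hne)
    have h3 : ∑ l, m l ≠ 0 := by
      intro h0
      obtain rfl : m = 0 :=
        Finsupp.ext fun l => Finset.sum_eq_zero_iff.1 h0 l (Finset.mem_univ _)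
      exact hm (DFunLike.congr_fun (hG i _) b')
    have h4 := ih b'
    rw [← h2]
    simp only [Pi.add_apply, Finset.sum_add_distrib]
    have h5 : (∑ l, (m l : ℤ)) = ((∑ l, m l : ℕ) : ℤ) := by push_cast; rfl
    push_cast
    omega

end BettiNumbers

end MultigradedBetti

end

theorem theorem4p2 {K : Type*} [Field K] {n : ℕ} {M : Type*} [AddCommGroup M]
    [Module (MvPolynomial (Fin n) K) M] [Module.Finite (MvPolynomial (Fin n) K) M]
    (ℳ : (Fin n → ℤ) → AddSubgroup M) [DirectSum.Decomposition ℳ]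
    [SetLike.GradedSMul (MultigradedBetti.polyPiece K n) ℳ]
    (k : ℕ) (hk : 1 ≤ k) (hkn : k ≤ n)
    (p : ℕ) (hkp : k ≤ p) (hp : MultigradedBetti.linBetti K ℳ k p ≠ 0)
    (i : ℕ) (hki : k ≤ i) (hip : i ≤ p) :
    (p.choose i : Cardinal) ≤ MultigradedBetti.linBetti K ℳ k i := by
  obtain ⟨c, hc⟩ := MultigradedBetti.exists_lower_bound (K := K) ℳ
  obtain ⟨G, hG, hGc⟩ := MultigradedBetti.exists_minimal_resolution (K := K) ℳ hc
  obtain ⟨β, hβ⟩ := (MultigradedBetti.betti_ne_zero_iff hG (hk.trans hkp) _).1 hp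
  obtain ⟨s, hs, hdeg⟩ := hG.exists_degrees hk
    (fun j hj b => MultigradedBetti.add_dk_le_of_deg hG hGc hk hj b) hβ hkp hki hip
  refine (Nat.cast_le.2 hs).trans (MultigradedBetti.card_le_betti s fun a ha => ?_)
  exact ⟨(hdeg a ha).1, (MultigradedBetti.multiBetti_ne_zero_iff hG (hk.trans hki) a).2
    (hdeg a ha).2⟩
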